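/- Let $\mathbb F$ be $\mathbb R$ or $\mathbb C$, let $M_2(\mathbb F)$ be the space of $2\times 2$ matrices over $\mathbb F$, let $A^*$ be the conjugate transpose of $A$ (the transpose if $\mathbb F=\mathbb R$), let $\|\cdot\|$ be the spectral norm, and let $\mathcal U_2(\mathbb F)=\{A\in M_2(\mathbb F): A^*A=I\}$. For $c>0$ let $\Phi_c\colon M_2(\mathbb R)\to M_2(\mathbb R)$ be the linear bijection with $$\Phi_c\begin{bmatrix} a&b\\-b&a\end{bmatrix}=\begin{bmatrix} a&b\\-b&a\end{bmatrix},\qquad \Phi_c\begin{bmatrix} a&b\\b&-a\end{bmatrix}=c\begin{bmatrix} a&b\\b&-a\end{bmatrix}\qquad(a,b\in\mathbb R),$$ and let $\mathbf V_3\subset M_2(\mathbb C)$ be the real span of $$I,\quad \begin{bmatrix}0&i\\i&0\end{bmatrix},\quad \begin{bmatrix}0&1\\-1&0\end{bmatrix},\quad \begin{bmatrix}i&0\\0&-i\end{bmatrix}.$$ Let $T\colon M_2(\mathbb F)\to M_2(\mathbb F)$ be a real-linear bijection. Then the following are equivalent. (a) $\|T(A)T(B)^*\|=\|T(A)\|\,\|T(B)^*\|$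 whenever $A,B\in M_2(\mathbb F)$ satisfy $\|AB^*\|=\|A\|\,\|B^*\|$. (b) $\|T(A)^*T(B)\|=\|T(A)^*\|\,\|T(B)\|$ whenever $A,B\in M_2(\mathbb F)$ satisfy $\|A^*B\|=\|A^*\|\,\|B\|$. (c) $T(I)$ is a nonzero scalar multiple of a matrix in $\mathcal U_2(\mathbb F)$, and the map $S\colon X\mapsto T(I)^{-1}T(X)$ has the following form. - If $\mathbb F=\mathbb R$: there exist a nonzero $\gamma\in\mathbb R$, $c>0$ and $U\in\mathcal U_2(\mathbb R)$ such that $S(A)=\gamma\,U\Phi_c(A)U^*$ for all $A\in M_2(\mathbb R)$. - If $\mathbb F=\mathbb C$: there exist $U,V\in\mathcal U_2(\mathbb C)$, $\gamma>0$ and $\mu\in\mathbb C\setminus\mathbb R$ such that $\gamma\,V\,S\bigl(U(X+iY)U^*\bigr)V^*=X+\mu Y$ for all $X,Y\in\mathbf V_3$; moreover, if $S$ is complex-linear, then $\mu=i$. -/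

import Mathlib

/- On matrices `‖A‖` is the spectral norm, i.e. the operator norm of `A` acting on the Euclidean
space (the largest singular value of `A`). -/
open scoped Matrix Matrix.Norms.L2Operator

/-- The space of `2 × 2` matrices over `𝕜`. -/
abbrev Mat2 (𝕜 : Type) : Type := Matrix (Fin 2) (Fin 2) 𝕜

/-- `T` preserves the pairs `(A, B)` with `‖A B*‖ = ‖A‖ ‖B*‖`. -/
def PreservesMulStar {𝕜 : Type} [RCLike 𝕜] (T : Mat2 𝕜 → Mat2 𝕜) : Prop :=
  ∀ A B : Mat2 𝕜, ‖A * Bᴴ‖ = ‖A‖ * ‖Bᴴ‖ → ‖T A * (T B)ᴴ‖ = ‖T A‖ * ‖(T B)ᴴ‖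

/-- `T` preserves the pairs `(A, B)` with `‖A* B‖ = ‖A*‖ ‖B‖`. -/
def PreservesStarMul {𝕜 : Type} [RCLike 𝕜] (T : Mat2 𝕜 → Mat2 𝕜) : Prop :=
  ∀ A B : Mat2 𝕜, ‖Aᴴ * B‖ = ‖Aᴴ‖ * ‖B‖ → ‖(T A)ᴴ * T B‖ = ‖(T A)ᴴ‖ * ‖T B‖

/-- `A` is a nonzero scalar multiple of a unitary (over `ℝ`: orthogonal) matrix. -/
def IsNonzeroMultipleOfUnitary {𝕜 : Type} [RCLike 𝕜] (A : Mat2 𝕜) : Prop :=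
  ∃ γ : 𝕜, γ ≠ 0 ∧ ∃ W ∈ Matrix.unitaryGroup (Fin 2) 𝕜, A = γ • W

/-- The linear map `Φ_c` on real `2 × 2` matrices which is the identity on the matrices
`[a, b; -b, a]` and multiplies the matrices `[a, b; b, -a]` by `c`. -/
noncomputable def Phi (c : ℝ) : Mat2 ℝ →ₗ[ℝ] Mat2 ℝ where
  toFun A :=
    !![(A 0 0 + A 1 1) / 2, (A 0 1 - A 1 0) / 2; -((A 0 1 - A 1 0) / 2), (A 0 0 + A 1 1) / 2] +
    c • !![(A 0 0 - A 1 1) / 2, (A 0 1 + A 1 0) / 2; (A 0 1 + A 1 0) / 2, -((A 0 0 - A 1 1) / 2)]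
  map_add' A B := by
    ext i j; fin_cases i <;> fin_cases j <;> simp <;> ring
  map_smul' r A := by
    ext i j; fin_cases i <;> fin_cases j <;> simp <;> ring

theorem Phi_rotation (c a b : ℝ) : Phi c !![a, b; -b, a] = !![a, b; -b, a] := by
  ext i j; fin_cases i <;> fin_cases j <;> simp [Phi]

theorem Phi_reflection (c a b : ℝ) : Phi c !![a, b; b, -a] = c • !![a, b; b, -a] := by
  ext i j; fin_cases i <;> fin_cases j <;> simp [Phi]

/-- The real span of `I` and the three quaternionic units
`Σ₁ = [0, i; i, 0]`, `Σ₂ = [0, 1; -1, 0]`, `Σ₃ = [i, 0; 0, -i]`. -/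
noncomputable def V3 : Submodule ℝ (Mat2 ℂ) :=
  Submodule.span ℝ
    {1, !![0, Complex.I; Complex.I, 0], !![0, 1; -1, 0], !![Complex.I, 0; 0, -Complex.I]}

/-- The real form: `S A = γ U Φ_c(A) U*` for some real `γ ≠ 0`, `c > 0` and orthogonal `U`. -/
def HasRealForm (S : Mat2 ℝ → Mat2 ℝ) : Prop :=
  ∃ γ : ℝ, γ ≠ 0 ∧ ∃ c : ℝ, 0 < c ∧ ∃ U ∈ Matrix.unitaryGroup (Fin 2) ℝ,
    ∀ A : Mat2 ℝ, S A = γ • (U * Phi c A * Uᴴ)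

/-- The complex form: for some unitary `U`, `V`, some `γ > 0` and some nonreal `μ`, the map
`X ↦ γ V S(U X U*) V*` is `X + iY ↦ X + μ Y` for `X, Y ∈ V3`; moreover `μ = i` if `S` is
complex-linear. -/
def HasComplexForm (S : Mat2 ℂ → Mat2 ℂ) : Prop :=
  ∃ U ∈ Matrix.unitaryGroup (Fin 2) ℂ, ∃ V ∈ Matrix.unitaryGroup (Fin 2) ℂ,
    ∃ γ : ℝ, 0 < γ ∧ ∃ μ : ℂ, μ.im ≠ 0 ∧
      (∀ X ∈ V3, ∀ Y ∈ V3,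
        γ • (V * S (U * (X + Complex.I • Y) * Uᴴ) * Vᴴ) = X + μ • Y) ∧
      (IsLinearMap ℂ S → μ = Complex.I)

/-! For a 2×2 matrix `A`, the product `AᴴA` is p times the identity plus a traceless Hermitian
matrix with eigenvalues ±r, and ‖A‖² = p + r. For nonzero `A` and `B`, ‖AB*‖ = ‖A‖‖B*‖ means that
`AᴴA` and `BᴴB` share a top eigenvector, that is, their traceless parts lie on one ray (zero lying
on every ray). The traceless part has a bilinear expression in suitable coordinates. Over ℝ, let A
be x ↦ z x + w conj x on the plane: it is encoded by conj z · w (`mulStarRel_rotRefl`). Over ℂ, let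
A = X + iY with quaternions X, Y: it is encoded by im(X*Y) (`mulStarRel_quatPair`). The problem
becomes one about linear maps that respect the rays of these invariants.

The matrices related to all others are those with zero invariant, the scalar multiples of unitaries.
A surjective preserver keeps this set, so T(1) is such a multiple and T may be normalized to S with
S(1) = 1.

Over ℝ this set is the union of the planes w = 0 and z = 0. A linear map sends each plane into one
of them, so S(z, w) = (f z, g w). The rays then force g = f · g(1) and f = id or conj
(`eq_mul_of_sameRay_preserving`), which is `Phi` up to an orthogonal conjugation.

Over ℂ the set consists of the pairs (X, Y) that are linearly dependent over ℝ. This forces S(X +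
iY) = P X + μ P Y with one linear map P of the quaternions and μ nonreal. Since P respects the rays
of im(X*Y), it preserves the quaternion multiplication table, hence is conjugation by a unit
quaternion (`exists_conjugation_of_sameRay_preserving`).

Finally, A ↦ (T A*)* exchanges conditions (a) and (b), and both classes of normal forms are stable
under it. -/

/-! ### Spectral norm through trace and determinant -/

section Norm

open scoped ComplexOrder

variable {𝕜 : Type} [RCLike 𝕜]

/-- The square of the Frobenius norm. -/
noncomputable def frobSq (M : Mat2 𝕜) : ℝ :=
  ‖M 0 0‖ ^ 2 + ‖M 0 1‖ ^ 2 + ‖M 1 0‖ ^ 2 + ‖M 1 1‖ ^ 2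

theorem trace_conjTranspose_mul_self_eq (M : Mat2 𝕜) :
    (Mᴴ * M).trace = ((frobSq M : ℝ) : 𝕜) := by
  simp only [Matrix.trace_fin_two, Matrix.mul_apply, Fin.sum_univ_two, Matrix.conjTranspose_apply,
    RCLike.star_def, RCLike.conj_mul, frobSq]
  push_cast
  ring

theorem norm_unitary_mul_mul (U V : Matrix.unitaryGroup (Fin 2) 𝕜) (A : Mat2 𝕜) :
    ‖(U : Mat2 𝕜) * A * (V : Mat2 𝕜)‖ = ‖A‖ := by
  rw [CStarRing.norm_mul_coe_unitary, CStarRing.norm_coe_unitary_mul]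

theorem exists_eigenvalues (M : Mat2 𝕜) :
    ∃ a b : ℝ, 0 ≤ a ∧ 0 ≤ b ∧ ‖M‖ ^ 2 = max a b ∧ frobSq M = a + b ∧ ‖M.det‖ ^ 2 = a * b := by
  have hP := Matrix.posSemidef_conjTranspose_mul_self M
  have hH := hP.isHermitian
  refine ⟨hH.eigenvalues 0, hH.eigenvalues 1, hP.eigenvalues_nonneg 0, hP.eigenvalues_nonneg 1,
    ?_, ?_, ?_⟩
  · have h1 : ‖Mᴴ * M‖ = ‖M‖ ^ 2 := by rw [Matrix.l2_opNorm_conjTranspose_mul_self, sq]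
    rw [← h1]
    conv_lhs => rw [hH.spectral_theorem, Unitary.conjStarAlgAut_apply]
    rw [show (star (hH.eigenvectorUnitary : Mat2 𝕜)) = ((star hH.eigenvectorUnitary :
      Matrix.unitaryGroup (Fin 2) 𝕜) : Mat2 𝕜) from rfl, norm_unitary_mul_mul,
      Matrix.l2_opNorm_diagonal]
    rw [Pi.norm_def]
    simp [Fin.univ_succ, abs_of_nonneg (hP.eigenvalues_nonneg _)]
  · have h := hH.trace_eq_sum_eigenvalues
    rw [trace_conjTranspose_mul_self_eq, Fin.sum_univ_two] at h
    exact_mod_cast h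
  · have h := hH.det_eq_prod_eigenvalues
    rw [Matrix.det_mul, Matrix.det_conjTranspose, Fin.prod_univ_two, RCLike.star_def,
      RCLike.conj_mul] at h
    exact_mod_cast h

/-- Here p ± r are the eigenvalues of `MᴴM`. -/
theorem exists_norm_sq_eq (M : Mat2 𝕜) :
    ∃ p r : ℝ, 0 ≤ r ∧ r ≤ p ∧ ‖M‖ ^ 2 = p + r ∧ frobSq M = 2 * p ∧
      ‖M.det‖ ^ 2 = p ^ 2 - r ^ 2 := by
  obtain ⟨a, b, ha, hb, h1, h2, h3⟩ := exists_eigenvalues M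
  rcases le_total a b with h | h
  · rw [max_eq_right h] at h1
    exact ⟨(a + b) / 2, (b - a) / 2, by linarith, by linarith, by linarith, by linarith,
      by rw [h3]; ring⟩
  · rw [max_eq_left h] at h1
    exact ⟨(a + b) / 2, (a - b) / 2, by linarith, by linarith, by linarith, by linarith,
      by rw [h3]; ring⟩

theorem norm_sq_eq_of_frobSq_of_det {M : Mat2 𝕜} {p r : ℝ} (hr : 0 ≤ r) (ht : frobSq M = 2 * p)
    (hd : ‖M.det‖ ^ 2 = p ^ 2 - r ^ 2) : ‖M‖ ^ 2 = p + r ∧ r ≤ p := by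
  obtain ⟨p', r', hr', hle, h1, h2, h3⟩ := exists_norm_sq_eq M
  obtain rfl : p' = p := by linarith
  obtain rfl : r' = r := by
    have : r' ^ 2 = r ^ 2 := by linarith
    exact (pow_left_inj₀ hr' hr two_ne_zero).1 this
  exact ⟨h1, hle⟩

/-- The pairs on which the spectral norm of `A * Bᴴ` is multiplicative, in terms of
Frobenius norms and determinants. -/
theorem norm_mul_conjTranspose_eq_iff {A B : Mat2 𝕜} {p r q s : ℝ} (hr : 0 ≤ r) (hs : 0 ≤ s)
    (hA : frobSq A = 2 * p) (hA' : ‖A.det‖ ^ 2 = p ^ 2 - r ^ 2)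
    (hB : frobSq B = 2 * q) (hB' : ‖B.det‖ ^ 2 = q ^ 2 - s ^ 2) :
    ‖A * Bᴴ‖ = ‖A‖ * ‖Bᴴ‖ ↔ frobSq (A * Bᴴ) = 2 * (p * q + r * s) := by
  obtain ⟨nA, hrp⟩ := norm_sq_eq_of_frobSq_of_det hr hA hA'
  obtain ⟨nB, hsq⟩ := norm_sq_eq_of_frobSq_of_det hs hB hB'
  obtain ⟨x, y, hy, hyx, h1, h2, h3⟩ := exists_norm_sq_eq (A * Bᴴ)
  have h4 : x ^ 2 - y ^ 2 = (p ^ 2 - r ^ 2) * (q ^ 2 - s ^ 2) := by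
    rw [← h3, ← hA', ← hB', Matrix.det_mul, Matrix.det_conjTranspose, norm_mul, norm_star]
    ring
  have h5 : ‖A * Bᴴ‖ = ‖A‖ * ‖Bᴴ‖ ↔ x + y = (p + r) * (q + s) := by
    rw [← h1, ← nA, ← nB, Matrix.l2_opNorm_conjTranspose, ← mul_pow,
      pow_left_inj₀ (norm_nonneg _) (by positivity) two_ne_zero]
  rw [h5, h2]
  constructor
  · intro h
    rcases eq_or_lt_of_le (show 0 ≤ x + y by linarith) with h0 | h0
    · have hx : x = 0 := by linarith
      rw [← h0] at h
      rcases mul_eq_zero.1 h.symm with h' | h'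
      · rw [hx, show p = 0 by linarith, show r = 0 by linarith]; ring
      · rw [hx, show q = 0 by linarith, show s = 0 by linarith]; ring
    -- The determinant is multiplicative, so once the larger eigenvalues multiply, the smaller ones
    -- do too; adding the two products gives x.
    · have : (x + y) * (x - y) = (x + y) * ((p - r) * (q - s)) := by
        linear_combination h4 - (p - r) * (q - s) * h
      have := mul_left_cancel₀ h0.ne' this
      linarith
  · intro h
    have hx : x = p * q + r * s := by linarith
    have : y ^ 2 = (p * s + r * q) ^ 2 := by
      rw [hx] at h4
      linear_combination -h4
    have := (pow_left_inj₀ hy (by nlinarith [mul_nonneg (hr.trans hrp) hs, mul_nonneg hr (hs.trans hsq)]) two_ne_zero).1 this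
    rw [hx, this]; ring

end Norm

/-! ### Two facts of linear algebra -/

section Linear

variable {V W : Type*} [AddCommGroup V] [Module ℝ V] [AddCommGroup W] [Module ℝ W]

/-- A linear map which is pointwise proportional to an injective one is proportional to it. -/
theorem LinearMap.eq_smul_of_forall_exists_smul {f g : V →ₗ[ℝ] W} (hf : Function.Injective f)
    (h : ∀ v, ∃ c : ℝ, g v = c • f v) {v₀ : V} (hv₀ : v₀ ≠ 0) {c : ℝ} (hc : g v₀ = c • f v₀)
    (v : V) : g v = c • f v := by
  by_cases hd : ∃ t : ℝ, v = t • v₀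
  · obtain ⟨t, rfl⟩ := hd
    rw [map_smul, map_smul, hc, smul_comm]
  obtain ⟨a, ha⟩ := h v
  obtain ⟨b, hb⟩ := h (v + v₀)
  -- Expand `g (v + v₀)` in two ways and cancel the injective `f`.
  have h1 : (a - b) • v + (c - b) • v₀ = 0 := by
    apply hf
    rw [map_add, ha, hc, map_add] at hb
    rw [map_add, map_smul, map_smul, map_zero]
    linear_combination (norm := module) hb
  have hab : a = b := by
    by_contra hne
    refine hd ⟨-((a - b)⁻¹ * (c - b)), ?_⟩
    have hne' : a - b ≠ 0 := sub_ne_zero.2 hne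
    have := congrArg (fun z => (a - b)⁻¹ • z) h1
    simp only [smul_add, smul_smul, inv_mul_cancel₀ hne', one_smul, smul_zero] at this
    rw [neg_smul]
    exact eq_neg_of_add_eq_zero_left this
  subst hab
  rw [sub_self, zero_smul, zero_add, smul_eq_zero, or_iff_left hv₀, sub_eq_zero] at h1
  rw [ha, h1]

/-- A vector space over `ℝ` is not the union of two proper subspaces. -/
theorem Submodule.eq_top_or_eq_top_of_forall_mem (p q : Submodule ℝ V)
    (h : ∀ v, v ∈ p ∨ v ∈ q) : p = ⊤ ∨ q = ⊤ := by
  by_contra! hne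
  obtain ⟨v, hv⟩ := (SetLike.exists_not_mem_of_ne_top p hne.1)
  obtain ⟨w, hw⟩ := (SetLike.exists_not_mem_of_ne_top q hne.2)
  have hv' := (h v).resolve_left hv
  have hw' := (h w).resolve_right hw
  rcases h (v + w) with h' | h'
  · exact hv (by simpa using p.sub_mem h' hw')
  · exact hw (by simpa using q.sub_mem h' hv')

end Linear

/-! ### Unitary equivalence, normalization and the adjoint symmetry -/

section MulStarForm

variable {𝕜 : Type} [RCLike 𝕜]

/-- The pairs `(A, B)` with `‖A B*‖ = ‖A‖ ‖B*‖`. -/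
def MulStarRel (A B : Mat2 𝕜) : Prop := ‖A * Bᴴ‖ = ‖A‖ * ‖Bᴴ‖

theorem norm_unitary_mul_mul' {U V : Mat2 𝕜} (hU : U ∈ Matrix.unitaryGroup (Fin 2) 𝕜)
    (hV : V ∈ Matrix.unitaryGroup (Fin 2) 𝕜) (A : Mat2 𝕜) : ‖U * A * V‖ = ‖A‖ :=
  norm_unitary_mul_mul ⟨U, hU⟩ ⟨V, hV⟩ A

theorem conjTranspose_mem_unitaryGroup {U : Mat2 𝕜} (hU : U ∈ Matrix.unitaryGroup (Fin 2) 𝕜) :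
    Uᴴ ∈ Matrix.unitaryGroup (Fin 2) 𝕜 := Unitary.star_mem hU

theorem conjTranspose_mul_self_of_mem {U : Mat2 𝕜} (hU : U ∈ Matrix.unitaryGroup (Fin 2) 𝕜) :
    Uᴴ * U = 1 := Unitary.star_mul_self_of_mem hU

theorem mul_conjTranspose_self_of_mem {U : Mat2 𝕜} (hU : U ∈ Matrix.unitaryGroup (Fin 2) 𝕜) :
    U * Uᴴ = 1 := Unitary.mul_star_self_of_mem hU

theorem mulStarRel_smul_unitary {k : 𝕜} (hk : k ≠ 0) {U V : Mat2 𝕜}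
    (hU : U ∈ Matrix.unitaryGroup (Fin 2) 𝕜) (hV : V ∈ Matrix.unitaryGroup (Fin 2) 𝕜)
    (A B : Mat2 𝕜) :
    MulStarRel (k • (U * A * V)) (k • (U * B * V)) ↔ MulStarRel A B := by
  have h1 : (k • (U * A * V)) * (k • (U * B * V))ᴴ = (k * star k) • (U * (A * Bᴴ) * Uᴴ) := by
    rw [Matrix.conjTranspose_smul, Matrix.conjTranspose_mul, Matrix.conjTranspose_mul,
      smul_mul_smul_comm]
    congr 1
    calc U * A * V * (Vᴴ * (Bᴴ * Uᴴ)) = U * A * (V * Vᴴ) * (Bᴴ * Uᴴ) := by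
          simp only [Matrix.mul_assoc]
      _ = _ := by rw [mul_conjTranspose_self_of_mem hV]; simp only [Matrix.mul_assoc, Matrix.one_mul]
  unfold MulStarRel
  rw [h1, Matrix.l2_opNorm_conjTranspose, Matrix.l2_opNorm_conjTranspose, norm_smul, norm_smul,
    norm_smul, norm_unitary_mul_mul' hU (conjTranspose_mem_unitaryGroup hU),
    norm_unitary_mul_mul' hU hV, norm_unitary_mul_mul' hU hV, norm_mul, norm_star]
  have hk' : ‖k‖ * ‖k‖ ≠ 0 := by simpa using hk
  rw [show ‖k‖ * ‖A‖ * (‖k‖ * ‖B‖) = ‖k‖ * ‖k‖ * (‖A‖ * ‖B‖) by ring]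
  exact mul_right_inj' hk'

/-- The map `A ↦ (T A*)*`. -/
def starConj (T : Mat2 𝕜 → Mat2 𝕜) : Mat2 𝕜 → Mat2 𝕜 := fun A => (T Aᴴ)ᴴ

theorem starConj_starConj (T : Mat2 𝕜 → Mat2 𝕜) : starConj (starConj T) = T := by
  funext A
  simp [starConj]

theorem preservesStarMul_iff_starConj {T : Mat2 𝕜 → Mat2 𝕜} :
    PreservesStarMul T ↔ PreservesMulStar (starConj T) := by
  constructor
  · intro h A B hAB
    simpa [starConj] using h Aᴴ Bᴴ (by simpa using hAB)
  · intro h A B hAB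
    simpa [starConj] using h Aᴴ Bᴴ (by simpa using hAB)

/-- The maps `A ↦ k W φ(A) V` with `φ` in a given class, `W` and `V` unitary, `k ≠ 0`. -/
def UnitaryForm (F : Set (Mat2 𝕜 → Mat2 𝕜)) (T : Mat2 𝕜 → Mat2 𝕜) : Prop :=
  ∃ k : 𝕜, k ≠ 0 ∧ ∃ W ∈ Matrix.unitaryGroup (Fin 2) 𝕜, ∃ V ∈ Matrix.unitaryGroup (Fin 2) 𝕜,
    ∃ φ ∈ F, ∀ A, T A = k • (W * φ A * V)

variable {F : Set (Mat2 𝕜 → Mat2 𝕜)} {T : Mat2 𝕜 → Mat2 𝕜}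

theorem UnitaryForm.preservesMulStar (hF : ∀ φ ∈ F, PreservesMulStar φ) (h : UnitaryForm F T) :
    PreservesMulStar T := by
  obtain ⟨k, hk, W, hW, V, hV, φ, hφ, hT⟩ := h
  intro A B hAB
  have := (mulStarRel_smul_unitary hk hW hV (φ A) (φ B)).2 (hF φ hφ A B hAB)
  rwa [← hT, ← hT] at this

theorem UnitaryForm.starConj (hF : ∀ φ ∈ F, starConj φ ∈ F) (h : UnitaryForm F T) :
    UnitaryForm F (starConj T) := by
  obtain ⟨k, hk, W, hW, V, hV, φ, hφ, hT⟩ := h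
  refine ⟨star k, star_ne_zero.2 hk, Vᴴ, conjTranspose_mem_unitaryGroup hV, Wᴴ,
    conjTranspose_mem_unitaryGroup hW, _root_.starConj φ, hF φ hφ, fun A => ?_⟩
  simp only [_root_.starConj, hT, Matrix.conjTranspose_smul, Matrix.conjTranspose_mul,
    Matrix.mul_assoc]

theorem UnitaryForm.smul_mul (h : UnitaryForm F T) {k : 𝕜} (hk : k ≠ 0) {U V : Mat2 𝕜}
    (hU : U ∈ Matrix.unitaryGroup (Fin 2) 𝕜) (hV : V ∈ Matrix.unitaryGroup (Fin 2) 𝕜)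
    {T' : Mat2 𝕜 → Mat2 𝕜} (hT' : ∀ A, T' A = k • (U * T A * V)) :
    UnitaryForm F T' := by
  obtain ⟨l, hl, W, hW, V', hV', φ, hφ, hT⟩ := h
  refine ⟨k * l, mul_ne_zero hk hl, U * W, mul_mem hU hW, V' * V, mul_mem hV' hV, φ, hφ,
    fun A => ?_⟩
  rw [hT', hT, mul_smul, Matrix.mul_smul, Matrix.smul_mul]
  simp only [Matrix.mul_assoc]

theorem inv_smul_unitary {k : 𝕜} (hk : k ≠ 0) {W : Mat2 𝕜}
    (hW : W ∈ Matrix.unitaryGroup (Fin 2) 𝕜) : (k • W)⁻¹ = k⁻¹ • Wᴴ := by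
  apply Matrix.inv_eq_left_inv
  rw [smul_mul_smul_comm, conjTranspose_mul_self_of_mem hW, inv_mul_cancel₀ hk, one_smul]

theorem IsNonzeroMultipleOfUnitary.isUnit_det {A : Mat2 𝕜} (h : IsNonzeroMultipleOfUnitary A) :
    IsUnit A.det := by
  obtain ⟨k, hk, W, hW, rfl⟩ := h
  refine Matrix.isUnit_det_of_left_inverse (B := k⁻¹ • Wᴴ) ?_
  rw [smul_mul_smul_comm, conjTranspose_mul_self_of_mem hW, inv_mul_cancel₀ hk, one_smul]

theorem bijective_inv_mul {A : Mat2 𝕜} (h : IsUnit A.det) :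
    Function.Bijective (fun X : Mat2 𝕜 => A⁻¹ * X) := by
  refine ⟨fun X Y hXY => ?_, fun X => ⟨A * X, Matrix.nonsing_inv_mul_cancel_left _ X h⟩⟩
  have := congrArg (A * ·) hXY
  simpa only [Matrix.mul_nonsing_inv_cancel_left _ _ h] using this

/-- Since φ fixes 1, T(1) = k W V; dividing by it on the left cancels k and W and leaves a
conjugation by V. -/
theorem UnitaryForm.normalized (hF : ∀ φ ∈ F, φ 1 = 1) (h : UnitaryForm F T) :
    IsNonzeroMultipleOfUnitary (T 1) ∧ ∃ V ∈ Matrix.unitaryGroup (Fin 2) 𝕜, ∃ φ ∈ F,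
      ∀ A, (T 1)⁻¹ * T A = Vᴴ * φ A * V := by
  obtain ⟨k, hk, W, hW, V, hV, φ, hφ, hT⟩ := h
  have h1 : T 1 = k • (W * V) := by rw [hT, hF φ hφ, Matrix.mul_one]
  refine ⟨⟨k, hk, W * V, mul_mem hW hV, h1⟩, V, hV, φ, hφ, fun A => ?_⟩
  rw [h1, inv_smul_unitary hk (mul_mem hW hV), hT, smul_mul_smul_comm, inv_mul_cancel₀ hk,
    one_smul, Matrix.conjTranspose_mul]
  calc Vᴴ * Wᴴ * (W * φ A * V) = Vᴴ * (Wᴴ * W) * φ A * V := by simp only [Matrix.mul_assoc]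
    _ = _ := by rw [conjTranspose_mul_self_of_mem hW, Matrix.mul_one]

theorem UnitaryForm.of_inv_mul (h1 : IsNonzeroMultipleOfUnitary (T 1))
    (h : UnitaryForm F (fun A => (T 1)⁻¹ * T A)) : UnitaryForm F T := by
  obtain ⟨k, hk, W, hW, hT⟩ := h1
  refine h.smul_mul hk hW (one_mem _) fun A => ?_
  rw [hT, inv_smul_unitary hk hW, Matrix.mul_one, Matrix.smul_mul, Matrix.mul_smul, smul_smul,
    mul_inv_cancel₀ hk, one_smul, ← Matrix.mul_assoc, mul_conjTranspose_self_of_mem hW,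
    Matrix.one_mul]

theorem PreservesMulStar.inv_mul (h1 : IsNonzeroMultipleOfUnitary (T 1))
    (h : PreservesMulStar T) : PreservesMulStar (fun A => (T 1)⁻¹ * T A) := by
  obtain ⟨k, hk, W, hW, hT⟩ := h1
  intro A B hAB
  have := (mulStarRel_smul_unitary (inv_ne_zero hk) (conjTranspose_mem_unitaryGroup hW)
    (one_mem _) (T A) (T B)).2 (h A B hAB)
  simpa only [MulStarRel, hT, inv_smul_unitary hk hW, Matrix.mul_one, Matrix.smul_mul] using this

/-- Only the implication from (a) to the normal form needs work in each field: applied to `starConj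
T` as well, it also yields the implication from (b). -/
theorem tfae_of_unitaryForm (hF : ∀ φ ∈ F, PreservesMulStar φ)
    (hF' : ∀ φ ∈ F, starConj φ ∈ F) (hT : PreservesMulStar T → UnitaryForm F T)
    (hT' : PreservesMulStar (starConj T) → UnitaryForm F (starConj T)) {P : Prop}
    (hP : P ↔ UnitaryForm F T) :
    List.TFAE [PreservesMulStar T, PreservesStarMul T, P] := by
  tfae_have 1 → 3 := fun h => hP.2 (hT h)
  tfae_have 3 → 1 := fun h => (hP.1 h).preservesMulStar hF
  tfae_have 2 → 3 := fun h => hP.2 (by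
    have := (hT' (preservesStarMul_iff_starConj.1 h)).starConj hF'
    rwa [starConj_starConj] at this)
  tfae_have 3 → 2 := fun h => preservesStarMul_iff_starConj.2
    (((hP.1 h).starConj hF').preservesMulStar hF)
  tfae_finish

end MulStarForm

/-! ### Real matrices as pairs of complex numbers -/

section Real

open ComplexConjugate

/-- The matrix of the real-linear map `x ↦ z x + w conj x` of the complex plane. -/
def rotRefl (z w : ℂ) : Mat2 ℝ :=
  !![z.re + w.re, w.im - z.im; z.im + w.im, z.re - w.re]

/-- The decomposition of a real matrix into a multiple of a rotation and one of a reflection. -/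
noncomputable def rotReflEquiv : (ℂ × ℂ) ≃ₗ[ℝ] Mat2 ℝ where
  toFun p := rotRefl p.1 p.2
  invFun A := (⟨(A 0 0 + A 1 1) / 2, (A 1 0 - A 0 1) / 2⟩,
    ⟨(A 0 0 - A 1 1) / 2, (A 1 0 + A 0 1) / 2⟩)
  map_add' p q := by
    ext i j; fin_cases i <;> fin_cases j <;> simp [rotRefl] <;> ring
  map_smul' r p := by
    ext i j; fin_cases i <;> fin_cases j <;> simp [rotRefl] <;> ring
  left_inv p := by
    refine Prod.ext (Complex.ext ?_ ?_) (Complex.ext ?_ ?_) <;> simp [rotRefl] <;> ring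
  right_inv A := by
    ext i j; fin_cases i <;> fin_cases j <;> simp [rotRefl] <;> ring

theorem rotReflEquiv_apply (z w : ℂ) : rotReflEquiv (z, w) = rotRefl z w := rfl

theorem exists_eq_rotRefl (A : Mat2 ℝ) : ∃ z w, A = rotRefl z w :=
  ⟨_, _, (rotReflEquiv.apply_symm_apply A).symm⟩

theorem rotRefl_inj {z w z' w' : ℂ} : rotRefl z w = rotRefl z' w' ↔ z = z' ∧ w = w' := by
  rw [← rotReflEquiv_apply, ← rotReflEquiv_apply, rotReflEquiv.injective.eq_iff, Prod.mk.injEq]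

theorem rotRefl_add (z w z' w' : ℂ) :
    rotRefl z w + rotRefl z' w' = rotRefl (z + z') (w + w') :=
  (rotReflEquiv.map_add (z, w) (z', w')).symm

theorem smul_rotRefl (r : ℝ) (z w : ℂ) : r • rotRefl z w = rotRefl (r • z) (r • w) :=
  (rotReflEquiv.map_smul r (z, w)).symm

theorem rotRefl_one_zero : rotRefl 1 0 = 1 := by
  ext i j; fin_cases i <;> fin_cases j <;> simp [rotRefl]

theorem rotRefl_zero_zero : rotRefl 0 0 = 0 := by
  ext i j; fin_cases i <;> fin_cases j <;> simp [rotRefl]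

theorem rotRefl_mul (z w z' w' : ℂ) :
    rotRefl z w * rotRefl z' w' = rotRefl (z * z' + w * conj w') (z * w' + w * conj z') := by
  ext i j; fin_cases i <;> fin_cases j <;>
    simp [rotRefl, Matrix.mul_apply, Fin.sum_univ_two] <;> ring

theorem conjTranspose_rotRefl (z w : ℂ) : (rotRefl z w)ᴴ = rotRefl (conj z) w := by
  ext i j; fin_cases i <;> fin_cases j <;> simp [rotRefl] <;> ring

theorem Phi_rotRefl (c : ℝ) (z w : ℂ) : Phi c (rotRefl z w) = rotRefl z (c • w) := by
  ext i j; fin_cases i <;> fin_cases j <;> simp [rotRefl, Phi] <;> ring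

theorem frobSq_rotRefl (z w : ℂ) :
    frobSq (rotRefl z w) = 2 * (Complex.normSq z + Complex.normSq w) := by
  simp [frobSq, rotRefl, Complex.normSq_apply]; ring

theorem det_rotRefl (z w : ℂ) :
    (rotRefl z w).det = Complex.normSq z - Complex.normSq w := by
  simp [rotRefl, Matrix.det_fin_two, Complex.normSq_apply]; ring

/-- For A = `rotRefl z w`, `AᴴA` = `rotRefl (|z|² + |w|²) (2 conj z w)`, so p = |z|² + |w|² and r =
2|conj z w|. The Frobenius criterion becomes equality in the Cauchy–Schwarz inequality for the two
invariants. -/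
theorem mulStarRel_rotRefl (z w z' w' : ℂ) :
    MulStarRel (rotRefl z w) (rotRefl z' w') ↔ SameRay ℝ (conj z * w) (conj z' * w') := by
  have hd : ∀ z w : ℂ, ‖(rotRefl z w).det‖ ^ 2 =
      (Complex.normSq z + Complex.normSq w) ^ 2 - (2 * ‖conj z * w‖) ^ 2 := by
    intro z w
    rw [det_rotRefl, Real.norm_eq_abs, sq_abs, mul_pow, ← Complex.normSq_eq_norm_sq, map_mul,
      Complex.normSq_conj]
    ring
  unfold MulStarRel
  rw [norm_mul_conjTranspose_eq_iff (by positivity) (by positivity) (frobSq_rotRefl z w) (hd z w)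
    (frobSq_rotRefl z' w') (hd z' w'), conjTranspose_rotRefl, rotRefl_mul, frobSq_rotRefl,
    sameRay_iff_norm_smul_eq, eq_comm (a := ‖conj z * w‖ • (conj z' * w')),
    ← inner_eq_norm_mul_iff_real, Complex.inner, mul_comm (conj z' * w')]
  have : Complex.normSq (z * conj z' + w * conj w') + Complex.normSq (z * w' + w * conj (conj z')) =
      (Complex.normSq z + Complex.normSq w) * (Complex.normSq z' + Complex.normSq w') +
      4 * (conj (conj z * w) * (conj z' * w')).re := by
    simp [Complex.normSq_apply]; ring
  rw [this]
  constructor <;> intro h <;> linarith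

theorem rotRefl_mem_unitaryGroup_left {u : ℂ} (hu : ‖u‖ = 1) :
    rotRefl u 0 ∈ Matrix.unitaryGroup (Fin 2) ℝ := by
  rw [Matrix.mem_unitaryGroup_iff, Matrix.star_eq_conjTranspose, conjTranspose_rotRefl, rotRefl_mul]
  simp [Complex.mul_conj, Complex.normSq_eq_norm_sq, hu, rotRefl_one_zero]

theorem rotRefl_mem_unitaryGroup_right {u : ℂ} (hu : ‖u‖ = 1) :
    rotRefl 0 u ∈ Matrix.unitaryGroup (Fin 2) ℝ := by
  rw [Matrix.mem_unitaryGroup_iff, Matrix.star_eq_conjTranspose, conjTranspose_rotRefl, rotRefl_mul]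
  simp [Complex.mul_conj, Complex.normSq_eq_norm_sq, hu, rotRefl_one_zero]

theorem forall_mulStarRel_rotRefl_iff (z w : ℂ) :
    (∀ B, MulStarRel (rotRefl z w) B) ↔ conj z * w = 0 := by
  constructor
  · intro h
    -- This test matrix has the opposite invariant.
    have := (mulStarRel_rotRefl z w 1 (-(conj z * w))).1 (h _)
    rw [map_one, one_mul] at this
    exact eq_zero_of_sameRay_self_neg this
  · intro h B
    obtain ⟨z', w', rfl⟩ := exists_eq_rotRefl B
    rw [mulStarRel_rotRefl, h]
    exact SameRay.zero_left _

theorem isNonzeroMultipleOfUnitary_real {A : Mat2 ℝ} (hA : A ≠ 0) (h : ∀ B, MulStarRel A B) :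
    IsNonzeroMultipleOfUnitary A := by
  obtain ⟨z, w, rfl⟩ := exists_eq_rotRefl A
  have key : ∀ z : ℂ, z ≠ 0 → ‖((‖z‖⁻¹ : ℝ) • z)‖ = 1 := fun z hz => by
    rw [norm_smul, norm_inv, norm_norm, inv_mul_cancel₀ (norm_ne_zero_iff.2 hz)]
  rcases mul_eq_zero.1 ((forall_mulStarRel_rotRefl_iff z w).1 h) with h0 | h0
  · obtain rfl : z = 0 := by simpa using h0
    have hw : w ≠ 0 := fun hw => hA (by rw [hw, rotRefl_zero_zero])
    refine ⟨‖w‖, norm_ne_zero_iff.2 hw, _, rotRefl_mem_unitaryGroup_right (key w hw), ?_⟩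
    rw [smul_rotRefl, smul_smul, mul_inv_cancel₀ (norm_ne_zero_iff.2 hw), one_smul, smul_zero]
  · subst h0
    have hz : z ≠ 0 := fun hz => hA (by rw [hz, rotRefl_zero_zero])
    refine ⟨‖z‖, norm_ne_zero_iff.2 hz, _, rotRefl_mem_unitaryGroup_left (key z hz), ?_⟩
    rw [smul_rotRefl, smul_smul, mul_inv_cancel₀ (norm_ne_zero_iff.2 hz), one_smul, smul_zero]

theorem mulStarRel_one_real (B : Mat2 ℝ) : MulStarRel 1 B := by
  rw [← rotRefl_one_zero]
  exact (forall_mulStarRel_rotRefl_iff 1 0).2 (by simp) B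

theorem preservesMulStar_Phi {c : ℝ} (hc : 0 < c) : PreservesMulStar (Phi c) := by
  intro A B hAB
  obtain ⟨z, w, rfl⟩ := exists_eq_rotRefl A
  obtain ⟨z', w', rfl⟩ := exists_eq_rotRefl B
  rw [Phi_rotRefl, Phi_rotRefl]
  refine (mulStarRel_rotRefl _ _ _ _).2 ?_
  have := (mulStarRel_rotRefl _ _ _ _).1 hAB
  rw [mul_smul_comm, mul_smul_comm]
  exact (this.pos_smul_left hc).pos_smul_right hc

theorem starConj_Phi (c : ℝ) : starConj (Phi c) = Phi c := by
  funext A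
  obtain ⟨z, w, rfl⟩ := exists_eq_rotRefl A
  rw [starConj, conjTranspose_rotRefl, Phi_rotRefl, conjTranspose_rotRefl, Complex.conj_conj,
    Phi_rotRefl]

/-- The maps `Phi c` with `c > 0`. -/
def PhiMaps : Set (Mat2 ℝ → Mat2 ℝ) := {φ | ∃ c : ℝ, 0 < c ∧ φ = Phi c}

/-- Pairs of real-linear maps of the plane which respect the rays of `conj z * w`. -/
theorem eq_mul_of_sameRay_preserving {f g : ℂ →ₗ[ℝ] ℂ} (hf : Function.Injective f)
    (hg : Function.Injective g) (hf1 : f 1 = 1)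
    (h : ∀ z w z' w' : ℂ, SameRay ℝ (conj z * w) (conj z' * w') →
      SameRay ℝ (conj (f z) * g w) (conj (f z') * g w')) :
    (∀ z, g z = f z * g 1) ∧ ((∀ z, f z = z) ∨ ∀ z, f z = conj z) := by
  have hg1 : g 1 ≠ 0 := fun h0 => one_ne_zero (hg (h0.trans g.map_zero.symm))
  have hgf : ∀ z, g z = f z * g 1 := by
    intro z
    have := LinearMap.eq_smul_of_forall_exists_smul (f := (LinearMap.mulRight ℝ (g 1)) ∘ₗ f)
      (g := g) (v₀ := 1) (c := 1) ?_ ?_ one_ne_zero (by simp [hf1]) z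
    · simpa using this
    · intro x y hxy
      exact hf (mul_right_cancel₀ hg1 (by simpa using hxy))
    · intro v
      rcases eq_or_ne v 0 with rfl | hv
      · exact ⟨0, by simp⟩
      have hfv : f v ≠ 0 := fun h0 => hv (hf (h0.trans f.map_zero.symm))
      -- The pairs (1, 1) and (v, v) have invariants 1 and |v|², on one ray. Hence conj (f v) · g v
      -- is a real multiple of g 1, and multiplying by f v gives the pointwise proportionality.
      have h1 := h 1 1 v v (by
        have : SameRay ℝ (1 : ℂ) (Complex.normSq v • (1 : ℂ)) :=
          SameRay.sameRay_nonneg_smul_right 1 (Complex.normSq_nonneg v)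
        rwa [map_one, one_mul, mul_comm (conj v), Complex.mul_conj, ← mul_one (Complex.normSq v : ℂ),
          ← Complex.real_smul])
      rw [hf1, map_one, one_mul] at h1
      obtain ⟨r, -, hr⟩ := h1.exists_nonneg_left hg1
      refine ⟨r / Complex.normSq (f v), ?_⟩
      have hn : (Complex.normSq (f v) : ℂ) ≠ 0 := by simpa using hfv
      simp only [LinearMap.comp_apply, LinearMap.mulRight_apply, Complex.real_smul] at hr ⊢
      rw [Complex.ofReal_div, div_mul_eq_mul_div, eq_div_iff hn, ← Complex.mul_conj]
      linear_combination -f v * hr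
  refine ⟨hgf, ?_⟩
  have h' : ∀ z w z' w' : ℂ, SameRay ℝ (conj z * w) (conj z' * w') →
      SameRay ℝ (conj (f z) * f w) (conj (f z') * f w') := by
    intro z w z' w' hs
    have := (h z w z' w' hs).map (LinearMap.mulRight ℝ (g 1)⁻¹)
    simpa [hgf w, hgf w', mul_assoc, hg1] using this
  have hfI : f Complex.I ≠ 0 := fun h0 => Complex.I_ne_zero (hf (h0.trans f.map_zero.symm))
  have hre : (f Complex.I).re = 0 := by
    -- Both pairs have invariant i, so -conj (f i) = r f i with r ≥ 0; comparing real parts gives Re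
    -- (f i) = 0.
    have h1 := h' 1 Complex.I Complex.I (-1) (by simp [SameRay.refl])
    obtain ⟨r, hr0, hr⟩ := h1.exists_nonneg_left (by simpa [hf1] using hfI)
    have := congrArg Complex.re hr
    simp [hf1] at this
    nlinarith [mul_self_nonneg (f Complex.I).re, mul_nonneg hr0 (mul_self_nonneg (f Complex.I).re)]
  set s := (f Complex.I).im with hs
  have hfI' : f Complex.I = s * Complex.I := by
    apply Complex.ext <;> simp [hre, hs]
  have hs0 : s ≠ 0 := fun h0 => hfI (by rw [hfI', h0]; simp)
  have hfz : ∀ z, f z = z.re + z.im * s * Complex.I := by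
    intro z
    have hz : z = z.re • (1 : ℂ) + z.im • Complex.I := by
      apply Complex.ext <;> simp
    conv_lhs => rw [hz]
    rw [map_add, map_smul, map_smul, hf1, hfI']
    simp [mul_assoc]
  have hss : s ^ 2 = 1 := by
    -- The invariants are 1 + i and 2(1 + i). Their images 1 + si and 2s² + 2si lie on one ray,
    -- which forces s² = 1.
    have h1 := h' 1 (1 + Complex.I) (1 + Complex.I) (2 * Complex.I) (by
      have : conj (1 + Complex.I) * (2 * Complex.I) = (2 : ℝ) • (conj 1 * (1 + Complex.I)) := by
        apply Complex.ext <;> simp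
      rw [this]
      exact SameRay.sameRay_nonneg_smul_right _ zero_le_two)
    have hne : conj (f 1) * f (1 + Complex.I) ≠ 0 := by
      intro h0
      have := congrArg Complex.re h0
      simp [hfz] at this
    obtain ⟨r, hr0, hr⟩ := h1.exists_nonneg_left hne
    have e1 := congrArg Complex.re hr
    have e2 := congrArg Complex.im hr
    simp [hfz] at e1 e2
    have h2 : r = 2 := by
      rcases e2 with h | h
      · exact h
      · exact absurd h hs0
    nlinarith
  rcases sq_eq_one_iff.1 hss with h1 | h1
  · left
    intro z
    rw [hfz, h1]
    apply Complex.ext <;> simp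
  · right
    intro z
    rw [hfz, h1]
    apply Complex.ext <;> simp

end Real

/-! ### The real normal form -/

section Real

open ComplexConjugate

theorem exists_eq_norm_smul_mul_self (g : ℂ) :
    ∃ u : ℂ, ‖u‖ = 1 ∧ g = ‖g‖ • (u * u) := by
  refine ⟨Complex.exp ((g.arg / 2 : ℝ) * Complex.I), Complex.norm_exp_ofReal_mul_I _, ?_⟩
  rw [← Complex.exp_add, Complex.real_smul]
  conv_lhs => rw [← Complex.norm_mul_exp_arg_mul_I g]
  congr 2
  push_cast
  ring

theorem mul_conj_self_of_norm_eq_one {u : ℂ} (hu : ‖u‖ = 1) : u * conj u = 1 := by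
  rw [Complex.mul_conj, Complex.normSq_eq_norm_sq, hu]; simp

theorem unitaryForm_PhiMaps_of_map_one {S : Mat2 ℝ →ₗ[ℝ] Mat2 ℝ} (hS : Function.Bijective S)
    (hS1 : S 1 = 1) (h : PreservesMulStar S) : UnitaryForm PhiMaps S := by
  have hrank : ∀ A : Mat2 ℝ, (∀ B, MulStarRel A B) → ∀ B, MulStarRel (S A) B := by
    intro A hA B
    obtain ⟨B, rfl⟩ := hS.2 B
    exact h A B (hA B)
  let fst : Mat2 ℝ →ₗ[ℝ] ℂ := LinearMap.fst ℝ ℂ ℂ ∘ₗ rotReflEquiv.symm.toLinearMap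
  let snd : Mat2 ℝ →ₗ[ℝ] ℂ := LinearMap.snd ℝ ℂ ℂ ∘ₗ rotReflEquiv.symm.toLinearMap
  have hfs : ∀ A, A = rotRefl (fst A) (snd A) := fun A =>
    (rotReflEquiv.apply_symm_apply A).symm
  let inl : ℂ →ₗ[ℝ] Mat2 ℝ := rotReflEquiv.toLinearMap ∘ₗ LinearMap.inl ℝ ℂ ℂ
  let inr : ℂ →ₗ[ℝ] Mat2 ℝ := rotReflEquiv.toLinearMap ∘ₗ LinearMap.inr ℝ ℂ ℂ
  have hinl : ∀ z, inl z = rotRefl z 0 := fun z => rfl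
  have hinr : ∀ z, inr z = rotRefl 0 z := fun z => rfl
  -- A linear space of multiples of orthogonal matrices is sent into the union of the planes z = 0
  -- and w = 0, hence into one of them.
  have hdich : ∀ j : ℂ →ₗ[ℝ] Mat2 ℝ, (∀ z B, MulStarRel (j z) B) →
      (∀ z, fst (S (j z)) = 0) ∨ ∀ z, snd (S (j z)) = 0 := by
    intro j hj
    have hker : ∀ z, z ∈ LinearMap.ker (fst ∘ₗ S ∘ₗ j) ∨ z ∈ LinearMap.ker (snd ∘ₗ S ∘ₗ j) := by
      intro z
      have := hrank _ (hj z)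
      rw [hfs (S (j z)), forall_mulStarRel_rotRefl_iff] at this
      simpa using this
    rcases Submodule.eq_top_or_eq_top_of_forall_mem _ _ hker with h' | h'
    · left
      intro z
      exact LinearMap.mem_ker.1 (h' ▸ Submodule.mem_top : z ∈ LinearMap.ker (fst ∘ₗ S ∘ₗ j))
    · right
      intro z
      exact LinearMap.mem_ker.1 (h' ▸ Submodule.mem_top : z ∈ LinearMap.ker (snd ∘ₗ S ∘ₗ j))
  have hl : ∀ z, snd (S (inl z)) = 0 := by
    refine (hdich inl fun z => ?_).resolve_left fun h0 => ?_
    · rw [hinl, forall_mulStarRel_rotRefl_iff, mul_zero]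
    · have h1 := h0 1
      rw [hinl, rotRefl_one_zero, hS1, ← rotRefl_one_zero] at h1
      have h2 := (rotRefl_inj.1 (hfs (rotRefl 1 0))).1
      exact one_ne_zero (h2.trans h1)
  have hr : ∀ z, fst (S (inr z)) = 0 := by
    refine (hdich inr fun z => ?_).resolve_right fun h0 => ?_
    · rw [hinr, forall_mulStarRel_rotRefl_iff, map_zero, zero_mul]
    -- If both planes went into w = 0, S would not be surjective.
    · obtain ⟨A, hA⟩ := hS.2 (rotRefl 0 1)
      obtain ⟨z, w, rfl⟩ := exists_eq_rotRefl A
      have h1 : rotRefl z w = inl z + inr w := by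
        rw [hinl, hinr, rotRefl_add, add_zero, zero_add]
      have h2 : snd (S (rotRefl z w)) = 0 := by
        rw [h1, map_add, map_add, hl, h0, add_zero]
      rw [hA] at h2
      exact one_ne_zero ((rotRefl_inj.1 (hfs (rotRefl 0 1))).2.trans h2)
  let f : ℂ →ₗ[ℝ] ℂ := fst ∘ₗ S ∘ₗ inl
  let g : ℂ →ₗ[ℝ] ℂ := snd ∘ₗ S ∘ₗ inr
  have hSl : ∀ z, S (rotRefl z 0) = rotRefl (f z) 0 := fun z => by
    rw [hfs (S (rotRefl z 0)), ← hinl, hl]; rfl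
  have hSr : ∀ w, S (rotRefl 0 w) = rotRefl 0 (g w) := fun z => by
    rw [hfs (S (rotRefl 0 z)), ← hinr, hr]; rfl
  have hSfg : ∀ z w, S (rotRefl z w) = rotRefl (f z) (g w) := by
    intro z w
    have h1 : rotRefl z w = rotRefl z 0 + rotRefl 0 w := by
      rw [rotRefl_add, add_zero, zero_add]
    rw [h1, map_add, hSl, hSr, rotRefl_add, add_zero, zero_add]
  have hf : Function.Injective f := fun z z' hz =>
    (rotRefl_inj.1 (hS.1 ((hSl z).trans ((congrArg (rotRefl · 0) hz).trans (hSl z').symm)))).1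
  have hg : Function.Injective g := fun z z' hz =>
    (rotRefl_inj.1 (hS.1 ((hSr z).trans ((congrArg (rotRefl 0 ·) hz).trans (hSr z').symm)))).2
  have hf1 : f 1 = 1 := by
    have := hSl 1
    rw [rotRefl_one_zero, hS1, ← rotRefl_one_zero] at this
    exact (rotRefl_inj.1 this).1.symm
  obtain ⟨hgf, hfc⟩ := eq_mul_of_sameRay_preserving hf hg hf1 fun z w z' w' hs => by
    have := h _ _ ((mulStarRel_rotRefl z w z' w').2 hs)
    rw [hSfg, hSfg] at this
    exact (mulStarRel_rotRefl _ _ _ _).1 this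
  have hg1 : g 1 ≠ 0 := fun h0 => one_ne_zero (hg (h0.trans g.map_zero.symm))
  -- Conjugation by the rotation u fixes z and multiplies w by u², so a square root of the phase of
  -- `g 1` is needed; c is then `‖g 1‖`.
  obtain ⟨u, hu, hgu⟩ := exists_eq_norm_smul_mul_self (g 1)
  have huu := mul_conj_self_of_norm_eq_one hu
  have hu' : ‖conj u‖ = 1 := by rw [RCLike.norm_conj, hu]
  rcases hfc with hfc | hfc
  · refine ⟨1, one_ne_zero, _, rotRefl_mem_unitaryGroup_left hu, _,
      rotRefl_mem_unitaryGroup_left hu', _, ⟨‖g 1‖, norm_pos_iff.2 hg1, rfl⟩, fun A => ?_⟩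
    obtain ⟨z, w, rfl⟩ := exists_eq_rotRefl A
    rw [hSfg, hgf, hfc, hfc, Phi_rotRefl, rotRefl_mul, rotRefl_mul, one_smul, rotRefl_inj]
    simp only [Complex.real_smul, Complex.conj_conj, map_zero, mul_zero, zero_mul, add_zero,
      zero_add] at hgu ⊢
    constructor
    · linear_combination -z * huu
    · linear_combination w * hgu
  -- Conjugation by the reflection u, its own inverse, sends (z, w) to (conj z, u² conj w).
  · refine ⟨1, one_ne_zero, _, rotRefl_mem_unitaryGroup_right hu, _,
      rotRefl_mem_unitaryGroup_right hu, _, ⟨‖g 1‖, norm_pos_iff.2 hg1, rfl⟩, fun A => ?_⟩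
    obtain ⟨z, w, rfl⟩ := exists_eq_rotRefl A
    rw [hSfg, hgf, hfc, hfc, Phi_rotRefl, rotRefl_mul, rotRefl_mul, one_smul, rotRefl_inj]
    simp only [Complex.real_smul, map_zero, mul_zero, zero_mul, add_zero,
      zero_add, map_mul, Complex.conj_ofReal] at hgu ⊢
    constructor
    · linear_combination -conj z * huu
    · linear_combination conj w * hgu

theorem unitaryForm_PhiMaps_of_preservesMulStar {T : Mat2 ℝ →ₗ[ℝ] Mat2 ℝ}
    (hT : Function.Bijective T) (h : PreservesMulStar T) : UnitaryForm PhiMaps T := by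
  have h1 : IsNonzeroMultipleOfUnitary (T 1) := by
    refine isNonzeroMultipleOfUnitary_real (fun h0 => ?_) fun B => ?_
    · exact one_ne_zero (hT.1 (h0.trans T.map_zero.symm))
    · obtain ⟨B, rfl⟩ := hT.2 B
      exact h 1 B (mulStarRel_one_real B)
  refine UnitaryForm.of_inv_mul h1 ?_
  have hdet := h1.isUnit_det
  have hb : Function.Bijective (LinearMap.mulLeft ℝ (T 1)⁻¹ ∘ₗ T) :=
    (bijective_inv_mul hdet).comp hT
  exact unitaryForm_PhiMaps_of_map_one hb (Matrix.nonsing_inv_mul _ hdet) (h.inv_mul h1)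

theorem hasRealForm_iff_unitaryForm {T : Mat2 ℝ → Mat2 ℝ} :
    IsNonzeroMultipleOfUnitary (T 1) ∧ HasRealForm (fun X => (T 1)⁻¹ * T X) ↔
      UnitaryForm PhiMaps T := by
  constructor
  · rintro ⟨h1, γ, hγ, c, hc, U, hU, hS⟩
    exact UnitaryForm.of_inv_mul h1
      ⟨γ, hγ, U, hU, Uᴴ, conjTranspose_mem_unitaryGroup hU, Phi c, ⟨c, hc, rfl⟩, hS⟩
  · intro h
    obtain ⟨h1, V, hV, φ, ⟨c, hc, rfl⟩, hS⟩ := h.normalized (by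
      rintro φ ⟨c, -, rfl⟩
      rw [← rotRefl_one_zero, Phi_rotRefl, smul_zero])
    refine ⟨h1, 1, one_ne_zero, c, hc, Vᴴ, conjTranspose_mem_unitaryGroup hV, fun A => ?_⟩
    rw [one_smul, Matrix.conjTranspose_conjTranspose]
    exact hS A

/-- The map `A ↦ (T A*)*` is linear and bijective along with `T`. -/
theorem exists_linearMap_starConj_real {T : Mat2 ℝ →ₗ[ℝ] Mat2 ℝ} (hT : Function.Bijective T) :
    ∃ T' : Mat2 ℝ →ₗ[ℝ] Mat2 ℝ, Function.Bijective T' ∧ ⇑T' = starConj T := by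
  let e := Matrix.conjTransposeLinearEquiv (Fin 2) (Fin 2) ℝ ℝ
  exact ⟨e.toLinearMap ∘ₗ T ∘ₗ e.toLinearMap, e.bijective.comp (hT.comp e.bijective), rfl⟩

theorem tfae_real (T : Mat2 ℝ →ₗ[ℝ] Mat2 ℝ) (hT : Function.Bijective T) :
    List.TFAE [PreservesMulStar T, PreservesStarMul T,
      IsNonzeroMultipleOfUnitary (T 1) ∧ HasRealForm (fun X => (T 1)⁻¹ * T X)] := by
  obtain ⟨T', hT', hTT'⟩ := exists_linearMap_starConj_real hT
  refine tfae_of_unitaryForm (F := PhiMaps) ?_ ?_ (unitaryForm_PhiMaps_of_preservesMulStar hT) ?_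
    hasRealForm_iff_unitaryForm
  · rintro φ ⟨c, hc, rfl⟩
    exact preservesMulStar_Phi hc
  · rintro φ ⟨c, hc, rfl⟩
    exact ⟨c, hc, starConj_Phi c⟩
  · rw [← hTT']
    exact unitaryForm_PhiMaps_of_preservesMulStar hT'

end Real

/-! ### Complex matrices as pairs of quaternions -/

section Complex

open ComplexConjugate
open scoped Quaternion

/-- The embedding of the quaternions into the complex `2 × 2` matrices. -/
noncomputable def quatMat : ℍ[ℝ] →ₗ[ℝ] Mat2 ℂ where
  toFun q := !![⟨q.re, q.imI⟩, ⟨q.imJ, q.imK⟩; ⟨-q.imJ, q.imK⟩, ⟨q.re, -q.imI⟩]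
  map_add' p q := by
    ext i j; fin_cases i <;> fin_cases j <;> apply Complex.ext <;> simp <;> ring
  map_smul' r q := by
    ext i j; fin_cases i <;> fin_cases j <;> apply Complex.ext <;> simp

theorem quatMat_apply (q : ℍ[ℝ]) :
    quatMat q = !![⟨q.re, q.imI⟩, ⟨q.imJ, q.imK⟩; ⟨-q.imJ, q.imK⟩, ⟨q.re, -q.imI⟩] := rfl

theorem quatMat_mk (a b c d : ℝ) :
    quatMat ⟨a, b, c, d⟩ = !![⟨a, b⟩, ⟨c, d⟩; ⟨-c, d⟩, ⟨a, -b⟩] := rfl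

theorem quatMat_one : quatMat 1 = 1 := by
  ext i j; fin_cases i <;> fin_cases j <;> apply Complex.ext <;> simp [quatMat_apply]

theorem quatMat_mul (p q : ℍ[ℝ]) : quatMat (p * q) = quatMat p * quatMat q := by
  ext i j; fin_cases i <;> fin_cases j <;> apply Complex.ext <;>
    simp [quatMat_apply, Matrix.mul_apply, Fin.sum_univ_two] <;> ring

theorem conjTranspose_quatMat (q : ℍ[ℝ]) : (quatMat q)ᴴ = quatMat (star q) := by
  ext i j; fin_cases i <;> fin_cases j <;> apply Complex.ext <;> simp [quatMat_apply]

theorem quatMat_mem_unitaryGroup {q : ℍ[ℝ]} (hq : ‖q‖ = 1) :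
    quatMat q ∈ Matrix.unitaryGroup (Fin 2) ℂ := by
  rw [Matrix.mem_unitaryGroup_iff, Matrix.star_eq_conjTranspose, conjTranspose_quatMat,
    ← quatMat_mul, Quaternion.self_mul_star, Quaternion.normSq_eq_norm_mul_self, hq, mul_one,
    Quaternion.coe_one, quatMat_one]

theorem mem_V3_iff {X : Mat2 ℂ} : X ∈ V3 ↔ ∃ q, quatMat q = X := by
  rw [← LinearMap.mem_range]
  suffices V3 = LinearMap.range quatMat by rw [this]
  apply le_antisymm
  · refine Submodule.span_le.2 ?_
    rintro X (rfl | rfl | rfl | rfl)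
    · exact ⟨1, quatMat_one⟩
    · refine ⟨⟨0, 0, 0, 1⟩, ?_⟩
      ext i j; fin_cases i <;> fin_cases j <;> apply Complex.ext <;> simp [quatMat_mk]
    · refine ⟨⟨0, 0, 1, 0⟩, ?_⟩
      ext i j; fin_cases i <;> fin_cases j <;> apply Complex.ext <;> simp [quatMat_mk]
    · refine ⟨⟨0, 1, 0, 0⟩, ?_⟩
      ext i j; fin_cases i <;> fin_cases j <;> apply Complex.ext <;> simp [quatMat_mk]
  · rintro _ ⟨q, rfl⟩
    have : quatMat q = q.re • (1 : Mat2 ℂ) + q.imK • !![0, Complex.I; Complex.I, 0] +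
        q.imJ • !![0, 1; -1, 0] + q.imI • !![Complex.I, 0; 0, -Complex.I] := by
      ext i j; fin_cases i <;> fin_cases j <;> apply Complex.ext <;> simp [quatMat_apply]
    rw [this]
    refine add_mem (add_mem (add_mem ?_ ?_) ?_) ?_ <;>
      exact Submodule.smul_mem _ _ (Submodule.subset_span (by simp))

/-- Every complex `2 × 2` matrix is uniquely `X + i Y` with quaternions `X` and `Y`. -/
noncomputable def quatPairEquiv : (ℍ[ℝ] × ℍ[ℝ]) ≃ₗ[ℝ] Mat2 ℂ where
  toFun p := quatMat p.1 + Complex.I • quatMat p.2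
  invFun A := (⟨((A 0 0).re + (A 1 1).re) / 2, ((A 0 0).im - (A 1 1).im) / 2,
      ((A 0 1).re - (A 1 0).re) / 2, ((A 0 1).im + (A 1 0).im) / 2⟩,
    ⟨((A 0 0).im + (A 1 1).im) / 2, ((A 1 1).re - (A 0 0).re) / 2,
      ((A 0 1).im - (A 1 0).im) / 2, -((A 0 1).re + (A 1 0).re) / 2⟩)
  map_add' p q := by
    simp only [Prod.fst_add, Prod.snd_add, map_add, smul_add]
    abel
  map_smul' r p := by
    simp only [Prod.smul_fst, Prod.smul_snd, map_smul, RingHom.id_apply, smul_add]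
    rw [smul_comm]
  left_inv p := by
    refine Prod.ext (Quaternion.ext _ _ ?_ ?_ ?_ ?_) (Quaternion.ext _ _ ?_ ?_ ?_ ?_) <;>
      simp [quatMat_apply] <;> ring
  right_inv A := by
    ext i j; fin_cases i <;> fin_cases j <;> apply Complex.ext <;> simp [quatMat_mk] <;> ring

/-- The matrix `X + i Y` of a pair of quaternions. -/
noncomputable def quatPair (X Y : ℍ[ℝ]) : Mat2 ℂ := quatMat X + Complex.I • quatMat Y

theorem quatPairEquiv_apply (X Y : ℍ[ℝ]) : quatPairEquiv (X, Y) = quatPair X Y := rfl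

theorem quatPairEquiv_symm_quatPair (X Y : ℍ[ℝ]) :
    quatPairEquiv.symm (quatPair X Y) = (X, Y) := quatPairEquiv.symm_apply_apply (X, Y)

theorem exists_eq_quatPair (A : Mat2 ℂ) : ∃ X Y, A = quatPair X Y :=
  ⟨_, _, (quatPairEquiv.apply_symm_apply A).symm⟩

theorem quatPair_inj {X Y X' Y' : ℍ[ℝ]} :
    quatPair X Y = quatPair X' Y' ↔ X = X' ∧ Y = Y' := by
  rw [← quatPairEquiv_apply, ← quatPairEquiv_apply, quatPairEquiv.injective.eq_iff, Prod.mk.injEq]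

theorem quatPair_add (X Y X' Y' : ℍ[ℝ]) :
    quatPair X Y + quatPair X' Y' = quatPair (X + X') (Y + Y') :=
  (quatPairEquiv.map_add (X, Y) (X', Y')).symm

theorem quatPair_zero_right (X : ℍ[ℝ]) : quatPair X 0 = quatMat X := by simp [quatPair]

theorem quatMat_add_smul_quatMat (μ : ℂ) (X Y : ℍ[ℝ]) :
    quatMat X + μ • quatMat Y = quatPair (X + μ.re • Y) (μ.im • Y) := by
  rw [quatPair, map_add, map_smul, map_smul]
  nth_rewrite 1 [← Complex.re_add_im μ]
  rw [add_smul, mul_comm, mul_smul, Complex.coe_smul, Complex.coe_smul, add_assoc]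

theorem conjTranspose_quatPair (X Y : ℍ[ℝ]) :
    (quatPair X Y)ᴴ = quatPair (star X) (-star Y) := by
  simp [quatPair, conjTranspose_quatMat]

theorem quatPair_mul (X Y X' Y' : ℍ[ℝ]) :
    quatPair X Y * quatPair X' Y' = quatPair (X * X' - Y * Y') (X * Y' + Y * X') := by
  simp only [quatPair, map_add, map_sub, quatMat_mul, add_mul, mul_add, Matrix.smul_mul,
    Matrix.mul_smul, smul_smul, Complex.I_mul_I, neg_smul, one_smul, smul_add]
  abel

theorem frobSq_quatPair (X Y : ℍ[ℝ]) :
    frobSq (quatPair X Y) = 2 * (Quaternion.normSq X + Quaternion.normSq Y) := by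
  simp [frobSq, quatPair, quatMat_apply, ← Complex.normSq_eq_norm_sq, Complex.normSq_apply,
    Quaternion.normSq_def']
  ring

theorem normSq_im_star_mul (X Y : ℍ[ℝ]) : Quaternion.normSq (star X * Y).im =
    Quaternion.normSq X * Quaternion.normSq Y - (star X * Y).re ^ 2 := by
  simp [Quaternion.normSq_def']
  ring

theorem norm_det_quatPair_sq (X Y : ℍ[ℝ]) : ‖(quatPair X Y).det‖ ^ 2 =
    (Quaternion.normSq X + Quaternion.normSq Y) ^ 2 - (2 * ‖(star X * Y).im‖) ^ 2 := by
  rw [mul_pow, sq ‖(star X * Y).im‖, ← Quaternion.normSq_eq_norm_mul_self, normSq_im_star_mul]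
  simp [Matrix.det_fin_two, quatPair, quatMat_apply, ← Complex.normSq_eq_norm_sq,
    Complex.normSq_apply, Quaternion.normSq_def']
  ring

/-- For A = X + iY, `AᴴA` = |X|² + |Y|² + 2i im(X*Y), so r = 2‖im(X*Y)‖. As over ℝ, the Frobenius
criterion is equality in Cauchy–Schwarz. -/
theorem mulStarRel_quatPair (X Y X' Y' : ℍ[ℝ]) :
    MulStarRel (quatPair X Y) (quatPair X' Y') ↔
      SameRay ℝ (star X * Y).im (star X' * Y').im := by
  unfold MulStarRel
  rw [norm_mul_conjTranspose_eq_iff (by positivity) (by positivity) (frobSq_quatPair X Y)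
    (norm_det_quatPair_sq X Y) (frobSq_quatPair X' Y') (norm_det_quatPair_sq X' Y'),
    conjTranspose_quatPair, quatPair_mul, frobSq_quatPair,
    sameRay_iff_norm_smul_eq, eq_comm (a := ‖(star X * Y).im‖ • (star X' * Y').im),
    ← inner_eq_norm_mul_iff_real, Quaternion.inner_def]
  have : Quaternion.normSq (X * star X' - Y * -star Y') +
      Quaternion.normSq (X * -star Y' + Y * star X') =
      (Quaternion.normSq X + Quaternion.normSq Y) * (Quaternion.normSq X' + Quaternion.normSq Y') +
      4 * ((star X * Y).im * star (star X' * Y').im).re := by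
    simp [Quaternion.normSq_def']; ring
  rw [this]
  constructor <;> intro h <;> linarith

theorem forall_mulStarRel_quatPair_iff (X Y : ℍ[ℝ]) :
    (∀ B, MulStarRel (quatPair X Y) B) ↔ (star X * Y).im = 0 := by
  constructor
  · intro h
    have := (mulStarRel_quatPair X Y 1 (-(star X * Y).im)).1 (h _)
    rw [star_one, one_mul, Quaternion.im_neg, Quaternion.im_idem] at this
    exact eq_zero_of_sameRay_self_neg this
  · intro h B
    obtain ⟨X', Y', rfl⟩ := exists_eq_quatPair B
    rw [mulStarRel_quatPair, h]
    exact SameRay.zero_left _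

theorem mulStarRel_one_complex (B : Mat2 ℂ) : MulStarRel 1 B := by
  rw [← quatMat_one, ← quatPair_zero_right]
  exact (forall_mulStarRel_quatPair_iff 1 0).2 (by simp) B

/-- If `conj X * Y` is real then `Y` is a real multiple of `X`. -/
theorem exists_eq_smul_of_im_star_mul_eq_zero {X Y : ℍ[ℝ]} (hX : X ≠ 0)
    (h : (star X * Y).im = 0) : ∃ t : ℝ, Y = t • X := by
  have hn : Quaternion.normSq X ≠ 0 := Quaternion.normSq_ne_zero.2 hX
  refine ⟨(Quaternion.normSq X)⁻¹ * (star X * Y).re, ?_⟩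
  have h1 : star X * Y = ((star X * Y).re : ℍ[ℝ]) := by
    conv_lhs => rw [← Quaternion.re_add_im (star X * Y), h, add_zero]
  have h2 : Quaternion.normSq X • Y = (star X * Y).re • X := by
    rw [← Quaternion.coe_mul_eq_smul, ← Quaternion.self_mul_star, mul_assoc, h1,
      Quaternion.mul_coe_eq_smul]
    simp
  rw [mul_smul, ← h2, smul_smul, inv_mul_cancel₀ hn, one_smul]

theorem im_star_mul_comm (X Y : ℍ[ℝ]) : (star Y * X).im = -(star X * Y).im := by
  rw [← Quaternion.im_star, star_mul, star_star]

theorem isNonzeroMultipleOfUnitary_smul_quatMat {k : ℂ} (hk : k ≠ 0) {q : ℍ[ℝ]} (hq : q ≠ 0) :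
    IsNonzeroMultipleOfUnitary (k • quatMat q) := by
  have hq' : ‖q‖ ≠ 0 := norm_ne_zero_iff.2 hq
  refine ⟨k * (‖q‖ : ℂ), mul_ne_zero hk (by exact_mod_cast hq'), quatMat (‖q‖⁻¹ • q),
    quatMat_mem_unitaryGroup ?_, ?_⟩
  · rw [norm_smul, norm_inv, norm_norm, inv_mul_cancel₀ hq']
  · rw [mul_smul, Complex.coe_smul, map_smul, smul_smul, mul_inv_cancel₀ hq', one_smul]

/-- Zero invariant means that X and Y are proportional over ℝ, so A is a complex scalar times one
quaternion. -/
theorem isNonzeroMultipleOfUnitary_complex {A : Mat2 ℂ} (hA : A ≠ 0) (h : ∀ B, MulStarRel A B) :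
    IsNonzeroMultipleOfUnitary A := by
  obtain ⟨X, Y, rfl⟩ := exists_eq_quatPair A
  have h0 := (forall_mulStarRel_quatPair_iff X Y).1 h
  rcases eq_or_ne X 0 with rfl | hX
  · have hY : Y ≠ 0 := by
      rintro rfl
      simp [quatPair] at hA
    have : quatPair 0 Y = Complex.I • quatMat Y := by simp [quatPair]
    rw [this]
    exact isNonzeroMultipleOfUnitary_smul_quatMat Complex.I_ne_zero hY
  · obtain ⟨t, rfl⟩ := exists_eq_smul_of_im_star_mul_eq_zero hX h0
    have : quatPair X (t • X) = (1 + Complex.I * t : ℂ) • quatMat X := by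
      rw [quatPair, map_smul, add_smul, one_smul, mul_smul, Complex.coe_smul]
    rw [this]
    refine isNonzeroMultipleOfUnitary_smul_quatMat (fun h0 => ?_) hX
    have := congrArg Complex.re h0
    simp at this

theorem sameRay_smul_smul_iff {V : Type*} [AddCommGroup V] [Module ℝ V] {c : ℝ} (hc : c ≠ 0)
    {x y : V} : SameRay ℝ (c • x) (c • y) ↔ SameRay ℝ x y := by
  have key : ∀ (d : ℝ) (x y : V), SameRay ℝ x y → SameRay ℝ (d • x) (d • y) := fun d x y h =>
    h.map (d • LinearMap.id)
  refine ⟨fun h => ?_, key c x y⟩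
  have := key c⁻¹ _ _ h
  rwa [smul_smul, smul_smul, inv_mul_cancel₀ hc, one_smul, one_smul] at this

theorem im_star_add_smul_mul_smul (a c : ℝ) (X Y : ℍ[ℝ]) :
    (star (X + a • Y) * (c • Y)).im = c • (star X * Y).im := by
  have h : (star Y * Y).im = 0 := by rw [Quaternion.star_mul_self, Quaternion.im_coe]
  rw [mul_smul_comm, Quaternion.im_smul, star_add, add_mul, Quaternion.im_add, Quaternion.star_smul,
    smul_mul_assoc, Quaternion.im_smul, h, smul_zero, add_zero]

/-- Replacing i by μ multiplies every invariant by the same nonzero real `μ.im`; its sign is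
immaterial, since both vectors flip together. -/
theorem mulStarRel_quatMat_add_smul {μ : ℂ} (hμ : μ.im ≠ 0) (X Y X' Y' : ℍ[ℝ]) :
    MulStarRel (quatMat X + μ • quatMat Y) (quatMat X' + μ • quatMat Y') ↔
      SameRay ℝ (star X * Y).im (star X' * Y').im := by
  rw [quatMat_add_smul_quatMat, quatMat_add_smul_quatMat, mulStarRel_quatPair,
    im_star_add_smul_mul_smul, im_star_add_smul_mul_smul, sameRay_smul_smul_iff hμ]

end Complex

/-! ### Recognizing conjugations of the quaternions -/

section Quaternion

open scoped Quaternion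

/-- The imaginary part of a quaternion as a linear map. -/
noncomputable def Quaternion.imLinearMap : ℍ[ℝ] →ₗ[ℝ] ℍ[ℝ] where
  toFun q := q.im
  map_add' := by simp
  map_smul' := by simp

theorem Quaternion.imLinearMap_apply (q : ℍ[ℝ]) : Quaternion.imLinearMap q = q.im := rfl

theorem Quaternion.eq_coe_re_of_im_eq_zero {q : ℍ[ℝ]} (h : q.im = 0) : q = (q.re : ℍ[ℝ]) := by
  conv_lhs => rw [← Quaternion.re_add_im q, h, add_zero]

/-- The first quaternion unit. -/
def quatI : ℍ[ℝ] := ⟨0, 1, 0, 0⟩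
/-- The second quaternion unit. -/
def quatJ : ℍ[ℝ] := ⟨0, 0, 1, 0⟩
/-- The third quaternion unit. -/
def quatK : ℍ[ℝ] := ⟨0, 0, 0, 1⟩

theorem quatI_components :
    quatI.re = 0 ∧ quatI.imI = 1 ∧ quatI.imJ = 0 ∧ quatI.imK = 0 := ⟨rfl, rfl, rfl, rfl⟩

theorem quatJ_components :
    quatJ.re = 0 ∧ quatJ.imI = 0 ∧ quatJ.imJ = 1 ∧ quatJ.imK = 0 := ⟨rfl, rfl, rfl, rfl⟩

theorem quatK_components :
    quatK.re = 0 ∧ quatK.imI = 0 ∧ quatK.imJ = 0 ∧ quatK.imK = 1 := ⟨rfl, rfl, rfl, rfl⟩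

theorem quatI_mul_quatI : quatI * quatI = -1 := by
  apply Quaternion.ext <;> simp [quatI_components]

theorem quatJ_mul_quatJ : quatJ * quatJ = -1 := by
  apply Quaternion.ext <;> simp [quatJ_components]

theorem quatI_mul_quatJ : quatI * quatJ = quatK := by
  apply Quaternion.ext <;> simp [quatI_components, quatJ_components, quatK_components]

theorem quatJ_mul_quatI : quatJ * quatI = -quatK := by
  apply Quaternion.ext <;> simp [quatI_components, quatJ_components, quatK_components]

theorem quatI_mul_quatK : quatI * quatK = -quatJ := by
  apply Quaternion.ext <;> simp [quatI_components, quatJ_components, quatK_components]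

theorem quatK_mul_quatI : quatK * quatI = quatJ := by
  apply Quaternion.ext <;> simp [quatI_components, quatJ_components, quatK_components]

theorem quatK_mul_quatJ : quatK * quatJ = -quatI := by
  apply Quaternion.ext <;> simp [quatI_components, quatJ_components, quatK_components]

theorem quat_eq_combination (X : ℍ[ℝ]) :
    X = X.re • (1 : ℍ[ℝ]) + X.imI • quatI + X.imJ • quatJ + X.imK • quatK := by
  apply Quaternion.ext <;> simp [quatI_components, quatJ_components, quatK_components]

theorem linearMap_quat_apply (P : ℍ[ℝ] →ₗ[ℝ] ℍ[ℝ]) (X : ℍ[ℝ]) :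
    P X = X.re • P 1 + X.imI • P quatI + X.imJ • P quatJ + X.imK • P quatK := by
  conv_lhs => rw [quat_eq_combination X]
  simp only [map_add, map_smul]

/-- A linear map of the quaternions which preserves the unit and the multiplication table is
conjugation by a unit quaternion. -/
theorem exists_forall_eq_mul_mul_star (P : ℍ[ℝ] →ₗ[ℝ] ℍ[ℝ]) (h1 : P 1 = 1)
    (hii : P quatI * P quatI = -1) (hjj : P quatJ * P quatJ = -1)
    (hij : P quatI * P quatJ = P quatK) (hji : P quatJ * P quatI = -P quatK) :
    ∃ p : ℍ[ℝ], ‖p‖ = 1 ∧ ∀ X, P X = p * X * star p := by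
  set x := P quatI
  set y := P quatJ
  set z := P quatK
  -- This is the sum of P(e) c e⁻¹ over e = 1, i, j, k, an average that intertwines P with the
  -- identity: P(X) r(c) = r(c) X.
  let r : ℍ[ℝ] → ℍ[ℝ] := fun c => c - x * c * quatI - y * c * quatJ - z * c * quatK
  have hxz : x * z = -y := by rw [← hij, ← mul_assoc, hii, neg_one_mul]
  have hyz : y * z = x := by
    rw [show z = -(y * x) by rw [hji, neg_neg], mul_neg, ← mul_assoc, hjj, neg_one_mul, neg_neg]
  have hxr : ∀ c, x * r c = r c * quatI := by
    intro c
    simp only [r, mul_sub, sub_mul, ← mul_assoc, hii, hij, hxz]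
    simp only [mul_assoc, quatI_mul_quatI, quatJ_mul_quatI, quatK_mul_quatI]
    noncomm_ring
  have hyr : ∀ c, y * r c = r c * quatJ := by
    intro c
    simp only [r, mul_sub, sub_mul, ← mul_assoc, hjj, hji, hyz]
    simp only [mul_assoc, quatJ_mul_quatJ, quatI_mul_quatJ, quatK_mul_quatJ]
    noncomm_ring
  have hzr : ∀ c, z * r c = r c * quatK := by
    intro c
    rw [← hij, mul_assoc, hyr, ← mul_assoc, hxr, mul_assoc, quatI_mul_quatJ]
  have hPr : ∀ c X, P X * r c = r c * X := by
    intro c X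
    rw [linearMap_quat_apply P X]
    conv_rhs => rw [quat_eq_combination X]
    simp only [add_mul, mul_add, smul_mul_assoc, mul_smul_comm, h1, one_mul, mul_one]
    rw [hxr, hyr, hzr]
  -- This combination does not depend on x, y, z, so some r(c) is nonzero.
  have hsum : r 1 - r quatI * quatI - r quatJ * quatJ - r quatK * quatK = ((4 : ℝ) : ℍ[ℝ]) := by
    apply Quaternion.ext <;> simp [r, quatI_components, quatJ_components, quatK_components] <;> ring
  obtain ⟨c, hc⟩ : ∃ c, r c ≠ 0 := by
    by_contra! h0
    rw [h0, h0, h0, h0] at hsum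
    have := congrArg QuaternionAlgebra.re hsum
    norm_num at this
  have hn : ‖r c‖ ≠ 0 := norm_ne_zero_iff.2 hc
  have hp : ‖‖r c‖⁻¹ • r c‖ = 1 := by
    rw [norm_smul, norm_inv, norm_norm, inv_mul_cancel₀ hn]
  refine ⟨‖r c‖⁻¹ • r c, hp, fun X => ?_⟩
  rw [smul_mul_assoc, ← hPr, ← mul_smul_comm, mul_assoc, Quaternion.self_mul_star,
    Quaternion.normSq_eq_norm_mul_self, hp]
  simp

/-- Real parts vanish for triples of quaternions with prescribed imaginary parts of products. -/
theorem re_smul_im_eq_of_im_star_mul {x y z : ℍ[ℝ]} (h1 : (star x * z).im = y.im)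
    (h2 : (star x * y).im = -z.im) (h3 : (star y * z).im = -x.im) :
    x.re • y.im = y.re • x.im ∧ y.re • z.im = z.re • y.im := by
  have p1 := congrArg QuaternionAlgebra.imI h1
  have p2 := congrArg QuaternionAlgebra.imJ h1
  have p3 := congrArg QuaternionAlgebra.imK h1
  have q1 := congrArg QuaternionAlgebra.imI h2
  have q2 := congrArg QuaternionAlgebra.imJ h2
  have q3 := congrArg QuaternionAlgebra.imK h2
  have r1 := congrArg QuaternionAlgebra.imI h3
  have r2 := congrArg QuaternionAlgebra.imJ h3
  have r3 := congrArg QuaternionAlgebra.imK h3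
  simp only [Quaternion.imI_im, Quaternion.imJ_im, Quaternion.imK_im, Quaternion.imI_mul,
    Quaternion.imJ_mul, Quaternion.imK_mul, Quaternion.re_star, Quaternion.imI_star,
    Quaternion.imJ_star, Quaternion.imK_star, Quaternion.imI_neg, Quaternion.imJ_neg,
    Quaternion.imK_neg] at p1 p2 p3 q1 q2 q3 r1 r2 r3
  -- Pairing a relation with the imaginary part of one of its own two factors kills the cross
  -- product. The right-hand sides then cancel in pairs, leaving a vanishing sum of squares.
  have key : Quaternion.normSq (x.re • y.im - y.re • x.im) +
      Quaternion.normSq (x.re • z.im - z.re • x.im) +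
      Quaternion.normSq (y.re • z.im - z.re • y.im) = 0 := by
    simp only [Quaternion.normSq_def', Quaternion.re_sub, Quaternion.imI_sub, Quaternion.imJ_sub,
      Quaternion.imK_sub, Quaternion.re_smul, Quaternion.imI_smul, Quaternion.imJ_smul,
      Quaternion.imK_smul, Quaternion.imI_im, Quaternion.imJ_im, Quaternion.imK_im,
      Quaternion.re_im, smul_eq_mul]
    linear_combination
      x.re * (z.imI * p1 + z.imJ * p2 + z.imK * p3 + (y.imI * q1 + y.imJ * q2 + y.imK * q3)) +
      y.re * (z.imI * r1 + z.imJ * r2 + z.imK * r3 - (x.imI * q1 + x.imJ * q2 + x.imK * q3)) -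
      z.re * (x.imI * p1 + x.imJ * p2 + x.imK * p3 + (y.imI * r1 + y.imJ * r2 + y.imK * r3))
  have n1 : 0 ≤ Quaternion.normSq (x.re • y.im - y.re • x.im) := Quaternion.normSq_nonneg
  have n2 : 0 ≤ Quaternion.normSq (x.re • z.im - z.re • x.im) := Quaternion.normSq_nonneg
  have n3 : 0 ≤ Quaternion.normSq (y.re • z.im - z.re • y.im) := Quaternion.normSq_nonneg
  exact ⟨sub_eq_zero.1 (Quaternion.normSq_eq_zero.1 (by linarith)),
    sub_eq_zero.1 (Quaternion.normSq_eq_zero.1 (by linarith))⟩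

/-- Recognition of the quaternion units among triples of pure quaternions. -/
theorem quat_table_of_im_star_mul {x y z : ℍ[ℝ]} (h1 : (star x * z).im = y.im)
    (h2 : (star x * y).im = -z.im) (h3 : (star y * z).im = -x.im)
    (hx0 : x.re = 0) (hy0 : y.re = 0) (hz0 : z.re = 0) (hx : x ≠ 0) :
    x * x = -1 ∧ y * y = -1 ∧ x * y = z ∧ y * x = -z := by
  have p1 := congrArg QuaternionAlgebra.imI h1
  have p2 := congrArg QuaternionAlgebra.imJ h1
  have p3 := congrArg QuaternionAlgebra.imK h1
  have q1 := congrArg QuaternionAlgebra.imI h2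
  have q2 := congrArg QuaternionAlgebra.imJ h2
  have q3 := congrArg QuaternionAlgebra.imK h2
  have r1 := congrArg QuaternionAlgebra.imI h3
  have r2 := congrArg QuaternionAlgebra.imJ h3
  have r3 := congrArg QuaternionAlgebra.imK h3
  simp only [Quaternion.imI_im, Quaternion.imJ_im, Quaternion.imK_im, Quaternion.imI_mul,
    Quaternion.imJ_mul, Quaternion.imK_mul, Quaternion.re_star, Quaternion.imI_star,
    Quaternion.imJ_star, Quaternion.imK_star, Quaternion.imI_neg, Quaternion.imJ_neg,
    Quaternion.imK_neg] at p1 p2 p3 q1 q2 q3 r1 r2 r3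
  rw [hx0, hy0] at q1 q2 q3
  rw [hx0, hz0] at p1 p2 p3
  rw [hy0, hz0] at r1 r2 r3
  have g12 : x.imI * y.imI + x.imJ * y.imJ + x.imK * y.imK = 0 := by
    linear_combination -(x.imI * p1 + x.imJ * p2 + x.imK * p3)
  have g33 : z.imI * z.imI + z.imJ * z.imJ + z.imK * z.imK =
      x.imI * x.imI + x.imJ * x.imJ + x.imK * x.imK := by
    linear_combination z.imI * q1 + z.imJ * q2 + z.imK * q3 -
      (x.imI * r1 + x.imJ * r2 + x.imK * r3)
  have g22 : y.imI * y.imI + y.imJ * y.imJ + y.imK * y.imK =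
      x.imI * x.imI + x.imJ * x.imJ + x.imK * x.imK := by
    linear_combination g33 - (y.imI * p1 + y.imJ * p2 + y.imK * p3) -
      (z.imI * q1 + z.imJ * q2 + z.imK * q3)
  -- With z = x × y, x ⊥ y and equal lengths, Lagrange's identity reads |x|² = |x|⁴.
  have hD : x.imI * x.imI + x.imJ * x.imJ + x.imK * x.imK = 1 := by
    have hne : x.imI * x.imI + x.imJ * x.imJ + x.imK * x.imK ≠ 0 := by
      intro h0
      refine hx (Quaternion.normSq_eq_zero.1 ?_)
      rw [Quaternion.normSq_def']
      linear_combination h0 + x.re * hx0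
    have z1 : z.imI = x.imJ * y.imK - x.imK * y.imJ := by linarith
    have z2 : z.imJ = x.imK * y.imI - x.imI * y.imK := by linarith
    have z3 : z.imK = x.imI * y.imJ - x.imJ * y.imI := by linarith
    refine mul_left_cancel₀ hne ?_
    rw [z1, z2, z3] at g33
    linear_combination g33 - (x.imI * x.imI + x.imJ * x.imJ + x.imK * x.imK) * g22 +
      (x.imI * y.imI + x.imJ * y.imJ + x.imK * y.imK) * g12
  refine ⟨?_, ?_, ?_, ?_⟩ <;> apply Quaternion.ext <;> simp [hx0, hy0, hz0] <;> linarith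

end Quaternion

/-! ### The complex normal form -/

section Complex

open ComplexConjugate
open scoped Quaternion

/-- Injective linear maps of the quaternions which fix `1` and respect the rays of
`im (conj X * Y)` are conjugations by unit quaternions. -/
theorem exists_conjugation_of_sameRay_preserving {P : ℍ[ℝ] →ₗ[ℝ] ℍ[ℝ]}
    (hP : Function.Injective P) (hP1 : P 1 = 1)
    (h : ∀ X Y X' Y' : ℍ[ℝ], SameRay ℝ (star X * Y).im (star X' * Y').im →
      SameRay ℝ (star (P X) * P Y).im (star (P X') * P Y').im) :
    ∃ p : ℍ[ℝ], ‖p‖ = 1 ∧ ∀ X, P X = p * X * star p := by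
  have him : ∀ X, (P X).im = 0 → X.im = 0 := by
    intro X hX
    have h1 : P X = P ((P X).re • (1 : ℍ[ℝ])) := by
      rw [map_smul, hP1]
      conv_lhs => rw [Quaternion.eq_coe_re_of_im_eq_zero hX]
      rw [← Quaternion.coe_mul_eq_smul, mul_one]
    rw [hP h1]
    simp
  -- The pairs (1, v) and (a, av) have the same invariant v, so the two sides are pointwise
  -- proportional linear maps of the pure quaternion v. The right one is injective there, and v = a
  -- shows that the factor is 1.
  have hunit : ∀ a : ℍ[ℝ], a.re = 0 → a * a = -1 → ∀ v : ℍ[ℝ], v.re = 0 →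
      (star (P a) * P (a * v)).im = (P v).im := by
    intro a ha haa v hv
    have hsa : star a = -a := by
      apply Quaternion.ext <;> simp [ha]
    have ha0 : a ≠ 0 := by
      rintro rfl
      have := congrArg QuaternionAlgebra.re haa
      simp at this
    let pure : Submodule ℝ ℍ[ℝ] := LinearMap.ker (LinearMap.id - Quaternion.imLinearMap)
    have hpure : ∀ w : ℍ[ℝ], w.re = 0 → w.im = w := fun w hw => by
      apply Quaternion.ext <;> simp [hw]
    have hmem : ∀ w : ℍ[ℝ], w.re = 0 → w ∈ pure := fun w hw => by
      rw [LinearMap.mem_ker, LinearMap.sub_apply, Quaternion.imLinearMap_apply, hpure w hw]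
      simp
    have hmem' : ∀ w ∈ pure, w.im = w := fun w hw => by
      rw [LinearMap.mem_ker, LinearMap.sub_apply, Quaternion.imLinearMap_apply, sub_eq_zero] at hw
      exact hw.symm
    let f : pure →ₗ[ℝ] ℍ[ℝ] := Quaternion.imLinearMap ∘ₗ P ∘ₗ pure.subtype
    let g : pure →ₗ[ℝ] ℍ[ℝ] := Quaternion.imLinearMap ∘ₗ LinearMap.mulLeft ℝ (star (P a)) ∘ₗ P ∘ₗ
      LinearMap.mulLeft ℝ a ∘ₗ pure.subtype
    have hf : ∀ w : pure, f w = (P w).im := fun w => rfl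
    have hg : ∀ w : pure, g w = (star (P a) * P (a * w)).im := fun w => rfl
    have hfinj : Function.Injective f := by
      rw [injective_iff_map_eq_zero]
      intro w hw
      ext1
      rw [← hmem' w w.2]
      exact him _ hw
    have := LinearMap.eq_smul_of_forall_exists_smul (f := f) (g := g) hfinj (fun w => ?_)
      (v₀ := ⟨a, hmem a ha⟩) (c := 1) (fun h0 => ha0 (congrArg Subtype.val h0)) ?_ ⟨v, hmem v hv⟩
    · rwa [one_smul, hf, hg] at this
    · rcases eq_or_ne w 0 with rfl | hw
      · exact ⟨0, by simp⟩
      · have h1 := h 1 w a (a * w) (by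
          rw [star_one, one_mul, ← mul_assoc, hsa, neg_mul, haa, neg_neg, one_mul])
        rw [hP1, star_one, one_mul] at h1
        obtain ⟨r, -, hr⟩ := h1.exists_nonneg_left fun h0 =>
          hw (hfinj (h0.trans f.map_zero.symm))
        exact ⟨r, hr.symm⟩
    · rw [one_smul, hf, hg, haa, map_neg, hP1, mul_neg, mul_one, Quaternion.im_neg,
        Quaternion.im_star, neg_neg]
  have h1 := hunit quatI rfl quatI_mul_quatI quatJ rfl
  have h2 := hunit quatI rfl quatI_mul_quatI quatK rfl
  have h3 := hunit quatJ rfl quatJ_mul_quatJ quatK rfl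
  have h3' := hunit quatJ rfl quatJ_mul_quatJ quatI rfl
  rw [quatI_mul_quatJ] at h1
  rw [quatI_mul_quatK, map_neg, mul_neg, Quaternion.im_neg, neg_eq_iff_eq_neg] at h2
  rw [quatJ_mul_quatI, map_neg, mul_neg, Quaternion.im_neg, neg_eq_iff_eq_neg] at h3'
  obtain ⟨k1, k2⟩ := re_smul_im_eq_of_im_star_mul h1 h2 h3'
  -- Applied to distinct units, which are independent, this makes the coefficients, the real parts
  -- of their images, vanish.
  have hre : ∀ X Y : ℍ[ℝ], ∀ a b : ℝ, a • (P X).im = b • (P Y).im → (a • X - b • Y).im = 0 := by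
    intro X Y a b hab
    apply him
    rw [map_sub, map_smul, map_smul, Quaternion.im_sub, Quaternion.im_smul, Quaternion.im_smul,
      hab, sub_self]
  have l1 := hre _ _ _ _ k1
  have l2 := hre _ _ _ _ k2
  have hy : (P quatJ).re = 0 := by
    simpa [quatI_components, quatJ_components] using congrArg QuaternionAlgebra.imI l1
  have hx : (P quatI).re = 0 := by
    simpa [quatI_components, quatJ_components] using congrArg QuaternionAlgebra.imJ l1
  have hz : (P quatK).re = 0 := by
    simpa [quatK_components, quatJ_components] using congrArg QuaternionAlgebra.imJ l2
  have hne : P quatI ≠ 0 := fun h0 => by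
    have := congrArg QuaternionAlgebra.imI (hP (h0.trans P.map_zero.symm))
    simp [quatI_components] at this
  obtain ⟨t1, t2, t3, t4⟩ := quat_table_of_im_star_mul h1 h2 h3' hx hy hz hne
  exact exists_forall_eq_mul_mul_star P hP1 t1 t2 t3 t4

/-- The map `X + i Y ↦ X + μ Y` for quaternions `X` and `Y`. -/
noncomputable def quatStretch (μ : ℂ) (A : Mat2 ℂ) : Mat2 ℂ :=
  quatMat (quatPairEquiv.symm A).1 + μ • quatMat (quatPairEquiv.symm A).2

theorem quatStretch_quatPair (μ : ℂ) (X Y : ℍ[ℝ]) :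
    quatStretch μ (quatPair X Y) = quatMat X + μ • quatMat Y := by
  rw [quatStretch, quatPairEquiv_symm_quatPair]

/-- The maps `X + i Y ↦ X + μ Y`, with `μ` nonreal, after a unitary conjugation. -/
def StretchMaps : Set (Mat2 ℂ → Mat2 ℂ) :=
  {φ | ∃ U ∈ Matrix.unitaryGroup (Fin 2) ℂ, ∃ μ : ℂ, μ.im ≠ 0 ∧
    φ = fun A => quatStretch μ (Uᴴ * A * U)}

theorem StretchMaps.preservesMulStar {φ : Mat2 ℂ → Mat2 ℂ} (hφ : φ ∈ StretchMaps) :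
    PreservesMulStar φ := by
  obtain ⟨U, hU, μ, hμ, rfl⟩ := hφ
  intro A B hAB
  have h1 := (mulStarRel_smul_unitary one_ne_zero (conjTranspose_mem_unitaryGroup hU) hU A B).2 hAB
  rw [one_smul, one_smul] at h1
  obtain ⟨X, Y, hA⟩ := exists_eq_quatPair (Uᴴ * A * U)
  obtain ⟨X', Y', hB⟩ := exists_eq_quatPair (Uᴴ * B * U)
  rw [hA, hB, mulStarRel_quatPair] at h1
  simp only [hA, hB, quatStretch_quatPair]
  exact (mulStarRel_quatMat_add_smul hμ X Y X' Y').2 h1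

/-- The adjoint turns (X, Y) into (X*, -Y*), so μ becomes -conj μ, with the same imaginary part. -/
theorem StretchMaps.starConj_mem {φ : Mat2 ℂ → Mat2 ℂ} (hφ : φ ∈ StretchMaps) :
    starConj φ ∈ StretchMaps := by
  obtain ⟨U, hU, μ, hμ, rfl⟩ := hφ
  refine ⟨U, hU, -star μ, by simpa using hμ, ?_⟩
  funext A
  obtain ⟨X, Y, hA⟩ := exists_eq_quatPair (Uᴴ * A * U)
  have hA' : Uᴴ * Aᴴ * U = quatPair (star X) (-star Y) := by
    rw [← conjTranspose_quatPair, ← hA]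
    simp only [Matrix.conjTranspose_mul, Matrix.conjTranspose_conjTranspose, Matrix.mul_assoc]
  simp only [starConj, hA, hA', quatStretch_quatPair]
  simp [conjTranspose_quatMat]

theorem quatStretch_one (μ : ℂ) : quatStretch μ 1 = 1 := by
  rw [← quatMat_one, ← quatPair_zero_right, quatStretch_quatPair]
  simp [quatPair_zero_right]

theorem StretchMaps.map_one {φ : Mat2 ℂ → Mat2 ℂ} (hφ : φ ∈ StretchMaps) : φ 1 = 1 := by
  obtain ⟨U, hU, μ, hμ, rfl⟩ := hφ
  simp only [Matrix.mul_one, conjTranspose_mul_self_of_mem hU, quatStretch_one]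

theorem hasComplexForm_iff_unitaryForm {T : Mat2 ℂ → Mat2 ℂ} :
    IsNonzeroMultipleOfUnitary (T 1) ∧ HasComplexForm (fun X => (T 1)⁻¹ * T X) ↔
      UnitaryForm StretchMaps T := by
  constructor
  · rintro ⟨h1, U, hU, V, hV, γ, hγ, μ, hμ, hS, -⟩
    refine UnitaryForm.of_inv_mul h1 ⟨(γ⁻¹ : ℝ), by exact_mod_cast inv_ne_zero hγ.ne', Vᴴ,
      conjTranspose_mem_unitaryGroup hV, V, hV, _, ⟨U, hU, μ, hμ, rfl⟩, fun A => ?_⟩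
    obtain ⟨X, Y, hA⟩ := exists_eq_quatPair (Uᴴ * A * U)
    have hA' : U * quatPair X Y * Uᴴ = A := by
      rw [← hA]
      calc U * (Uᴴ * A * U) * Uᴴ = (U * Uᴴ) * A * (U * Uᴴ) := by simp only [Matrix.mul_assoc]
        _ = A := by rw [mul_conjTranspose_self_of_mem hU, Matrix.one_mul, Matrix.mul_one]
    have h2 := hS _ (mem_V3_iff.2 ⟨X, rfl⟩) _ (mem_V3_iff.2 ⟨Y, rfl⟩)
    rw [← quatPair, hA', ← quatStretch_quatPair, ← hA] at h2
    simp only [← h2]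
    rw [Matrix.mul_smul, Matrix.smul_mul, Complex.coe_smul, smul_smul, inv_mul_cancel₀ hγ.ne',
      one_smul]
    calc (T 1)⁻¹ * T A = (Vᴴ * V) * ((T 1)⁻¹ * T A) * (Vᴴ * V) := by
          rw [conjTranspose_mul_self_of_mem hV, Matrix.one_mul, Matrix.mul_one]
      _ = _ := by simp only [Matrix.mul_assoc]
  · intro h
    obtain ⟨h1, V, hV, φ, ⟨U, hU, μ, hμ, rfl⟩, hS⟩ := h.normalized fun φ => StretchMaps.map_one
    have hform : ∀ X ∈ V3, ∀ Y ∈ V3,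
        V * ((T 1)⁻¹ * T (U * (X + Complex.I • Y) * Uᴴ)) * Vᴴ = X + μ • Y := by
      intro X hX Y hY
      obtain ⟨X, rfl⟩ := mem_V3_iff.1 hX
      obtain ⟨Y, rfl⟩ := mem_V3_iff.1 hY
      rw [hS, ← quatPair]
      have hA : Uᴴ * (U * quatPair X Y * Uᴴ) * U = quatPair X Y := by
        calc Uᴴ * (U * quatPair X Y * Uᴴ) * U = (Uᴴ * U) * quatPair X Y * (Uᴴ * U) := by
              simp only [Matrix.mul_assoc]
          _ = _ := by rw [conjTranspose_mul_self_of_mem hU, Matrix.one_mul, Matrix.mul_one]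
      simp only [hA, quatStretch_quatPair]
      generalize quatMat X + μ • quatMat Y = B
      calc V * (Vᴴ * B * V) * Vᴴ = (V * Vᴴ) * B * (V * Vᴴ) := by simp only [Matrix.mul_assoc]
        _ = B := by rw [mul_conjTranspose_self_of_mem hV, Matrix.one_mul, Matrix.mul_one]
    refine ⟨h1, U, hU, V, hV, 1, one_pos, μ, hμ, fun X hX Y hY => ?_, fun hlin => ?_⟩
    · rw [one_smul]
      exact hform X hX Y hY
    -- Evaluate S(i·1): the normal form gives μ·1, complex linearity gives i·1.
    · have h2 := hform 0 (zero_mem _) 1 (mem_V3_iff.2 ⟨1, quatMat_one⟩)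
      rw [zero_add, zero_add, Matrix.mul_smul, Matrix.mul_one, Matrix.smul_mul,
        mul_conjTranspose_self_of_mem hU] at h2
      have h3 := hlin.map_smul Complex.I 1
      simp only [Matrix.nonsing_inv_mul _ h1.isUnit_det] at h3
      rw [h3, Matrix.mul_smul, Matrix.mul_one, Matrix.smul_mul,
        mul_conjTranspose_self_of_mem hV] at h2
      simpa using (congrFun (congrFun h2 0) 0).symm

theorem unitaryForm_StretchMaps_of_map_one {S : Mat2 ℂ →ₗ[ℝ] Mat2 ℂ} (hS : Function.Bijective S)
    (hS1 : S 1 = 1) (h : PreservesMulStar S) : UnitaryForm StretchMaps S := by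
  have hrank : ∀ X Y X' Y' : ℍ[ℝ], (star X * Y).im = 0 → S (quatPair X Y) = quatPair X' Y' →
      (star X' * Y').im = 0 := by
    intro X Y X' Y' hXY hXY'
    rw [← forall_mulStarRel_quatPair_iff, ← hXY']
    intro B
    obtain ⟨B, rfl⟩ := hS.2 B
    exact h _ B ((forall_mulStarRel_quatPair_iff X Y).2 hXY B)
  let fst : Mat2 ℂ →ₗ[ℝ] ℍ[ℝ] := LinearMap.fst ℝ ℍ[ℝ] ℍ[ℝ] ∘ₗ quatPairEquiv.symm.toLinearMap
  let snd : Mat2 ℂ →ₗ[ℝ] ℍ[ℝ] := LinearMap.snd ℝ ℍ[ℝ] ℍ[ℝ] ∘ₗ quatPairEquiv.symm.toLinearMap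
  have hfs : ∀ A, A = quatPair (fst A) (snd A) := fun A =>
    (quatPairEquiv.apply_symm_apply A).symm
  have hfst : ∀ X Y, fst (quatPair X Y) = X := fun X Y =>
    congrArg Prod.fst (quatPairEquiv_symm_quatPair X Y)
  have hsnd : ∀ X Y, snd (quatPair X Y) = Y := fun X Y =>
    congrArg Prod.snd (quatPairEquiv_symm_quatPair X Y)
  let inl : ℍ[ℝ] →ₗ[ℝ] Mat2 ℂ := quatPairEquiv.toLinearMap ∘ₗ LinearMap.inl ℝ ℍ[ℝ] ℍ[ℝ]
  let inr : ℍ[ℝ] →ₗ[ℝ] Mat2 ℂ := quatPairEquiv.toLinearMap ∘ₗ LinearMap.inr ℝ ℍ[ℝ] ℍ[ℝ]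
  let P : ℍ[ℝ] →ₗ[ℝ] ℍ[ℝ] := fst ∘ₗ S ∘ₗ inl
  let g : ℍ[ℝ] →ₗ[ℝ] ℍ[ℝ] := snd ∘ₗ S ∘ₗ inl
  let p : ℍ[ℝ] →ₗ[ℝ] ℍ[ℝ] := fst ∘ₗ S ∘ₗ inr
  let k : ℍ[ℝ] →ₗ[ℝ] ℍ[ℝ] := snd ∘ₗ S ∘ₗ inr
  have hSl : ∀ X, S (quatPair X 0) = quatPair (P X) (g X) := fun X => hfs _
  have hSr : ∀ X, S (quatPair 0 X) = quatPair (p X) (k X) := fun X => hfs _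
  have hS1' : S (quatPair 1 0) = quatPair 1 0 := by
    rw [quatPair_zero_right, quatMat_one, hS1]
  have hP1 : P 1 = 1 := (quatPair_inj.1 ((hSl 1).symm.trans hS1')).1
  have hg1 : g 1 = 0 := (quatPair_inj.1 ((hSl 1).symm.trans hS1')).2
  have hgim : ∀ X, (star (P X) * g X).im = 0 := fun X => hrank X 0 _ _ (by simp) (hSl X)
  -- Polarize the previous identity between X and 1, where P is 1 and g is 0.
  have hgre : ∀ X, (g X).im = 0 := by
    intro X
    have h1 := hgim (X + 1)
    rw [map_add, map_add, hP1, hg1, add_zero, star_add, star_one, add_mul, one_mul,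
      Quaternion.im_add, hgim, zero_add] at h1
    exact h1
  -- For each X, g X = 0 or P X is real, so one alternative holds for all X. If P were always real,
  -- the injective map X ↦ (P X, g X) would send four dimensions into two.
  have hg0 : ∀ X, g X = 0 := by
    have hker : ∀ X, X ∈ LinearMap.ker g ∨ X ∈ LinearMap.ker (Quaternion.imLinearMap ∘ₗ P) := by
      intro X
      have h1 := hgim X
      rw [Quaternion.eq_coe_re_of_im_eq_zero (hgre X), Quaternion.mul_coe_eq_smul,
        Quaternion.im_smul, smul_eq_zero, Quaternion.im_star, neg_eq_zero] at h1
      refine h1.imp (fun h2 => ?_) fun h2 => h2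
      rw [LinearMap.mem_ker, Quaternion.eq_coe_re_of_im_eq_zero (hgre X), h2, Quaternion.coe_zero]
    rcases Submodule.eq_top_or_eq_top_of_forall_mem _ _ hker with h' | h'
    · exact fun X => LinearMap.mem_ker.1 (h' ▸ Submodule.mem_top : X ∈ LinearMap.ker g)
    · exfalso
      have hPim : ∀ X, (P X).im = 0 := fun X => LinearMap.mem_ker.1
        (h' ▸ Submodule.mem_top : X ∈ LinearMap.ker (Quaternion.imLinearMap ∘ₗ P))
      let re : ℍ[ℝ] →ₗ[ℝ] ℝ :=
        { toFun := fun q => q.re, map_add' := by simp, map_smul' := by simp }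
      have hinj : Function.Injective ((re ∘ₗ P).prod (re ∘ₗ g)) := by
        intro X Y hXY
        have e1 : (P X).re = (P Y).re := congrArg Prod.fst hXY
        have e2 : (g X).re = (g Y).re := congrArg Prod.snd hXY
        have e3 : S (quatPair X 0) = S (quatPair Y 0) := by
          rw [hSl, hSl, Quaternion.eq_coe_re_of_im_eq_zero (hPim X),
            Quaternion.eq_coe_re_of_im_eq_zero (hPim Y),
            Quaternion.eq_coe_re_of_im_eq_zero (hgre X),
            Quaternion.eq_coe_re_of_im_eq_zero (hgre Y), e1, e2]
        exact (quatPair_inj.1 (hS.1 e3)).1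
      have := LinearMap.finrank_le_finrank_of_injective hinj
      rw [Quaternion.finrank_eq_four] at this
      simp at this
  have hSP : ∀ X, S (quatPair X 0) = quatPair (P X) 0 := fun X => by rw [hSl, hg0]
  have hPinj : Function.Injective P := fun X Y hXY =>
    (quatPair_inj.1 (hS.1 ((hSP X).trans ((congrArg (quatPair · 0) hXY).trans (hSP Y).symm)))).1
  have hPne : ∀ X, X ≠ 0 → P X ≠ 0 := fun X hX h0 => hX (hPinj (h0.trans P.map_zero.symm))
  have hSXY : ∀ X Y, S (quatPair X Y) = quatPair (P X + p Y) (k Y) := by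
    intro X Y
    have h1 : quatPair X Y = quatPair X 0 + quatPair 0 Y := by
      rw [quatPair_add, add_zero, zero_add]
    rw [h1, map_add, hSP, hSr, quatPair_add, zero_add]
  have hpk : ∀ X, (star (p X) * k X).im = 0 := fun X => hrank 0 X _ _ (by simp) (hSr X)
  -- Use the pair (X, X), whose invariant is zero.
  have hPk : ∀ X, (star (P X) * k X).im = 0 := by
    intro X
    have h1 := hrank X X _ _ (by rw [Quaternion.star_mul_self, Quaternion.im_coe]) (hSXY X X)
    rwa [star_add, add_mul, Quaternion.im_add, hpk, add_zero] at h1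
  have hsmul : ∀ q : ℍ[ℝ] →ₗ[ℝ] ℍ[ℝ], (∀ X, (star (P X) * q X).im = 0) →
      ∃ c : ℝ, ∀ X, q X = c • P X := by
    intro q hq
    have hex : ∀ X, ∃ c : ℝ, q X = c • P X := by
      intro X
      rcases eq_or_ne X 0 with rfl | hX
      · exact ⟨0, by simp⟩
      · exact exists_eq_smul_of_im_star_mul_eq_zero (hPne X hX) (hq X)
    obtain ⟨c, hc⟩ := hex 1
    exact ⟨c, LinearMap.eq_smul_of_forall_exists_smul hPinj hex one_ne_zero hc⟩
  obtain ⟨c, hc⟩ := hsmul k hPk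
  have hc0 : c ≠ 0 := by
    rintro rfl
    obtain ⟨A, hA⟩ := hS.2 (quatPair 0 1)
    obtain ⟨X, Y, rfl⟩ := exists_eq_quatPair A
    rw [hSXY, hc, zero_smul] at hA
    exact zero_ne_one (quatPair_inj.1 hA).2
  obtain ⟨a, ha⟩ := hsmul p fun X => by
    have h1 := hpk X
    rw [hc, mul_smul_comm, Quaternion.im_smul, smul_eq_zero, or_iff_right hc0] at h1
    rw [im_star_mul_comm, h1, neg_zero]
  -- With p = a P and k = c P, the scalar is μ = a + ci, nonreal because c ≠ 0.
  have hSμ : ∀ X Y, S (quatPair X Y) = quatMat (P X) + (⟨a, c⟩ : ℂ) • quatMat (P Y) := by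
    intro X Y
    rw [hSXY, hc, ha, quatMat_add_smul_quatMat]
  obtain ⟨u, hu, hPu⟩ := exists_conjugation_of_sameRay_preserving hPinj hP1 fun X Y X' Y' hs => by
    have h1 := h _ _ ((mulStarRel_quatPair X Y X' Y').2 hs)
    rw [hSμ, hSμ] at h1
    exact (mulStarRel_quatMat_add_smul (μ := ⟨a, c⟩) hc0 _ _ _ _).1 h1
  refine ⟨1, one_ne_zero, quatMat u, quatMat_mem_unitaryGroup hu, quatMat (star u),
    quatMat_mem_unitaryGroup (by rwa [norm_star]), _, ⟨1, one_mem _, ⟨a, c⟩, hc0, rfl⟩,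
    fun A => ?_⟩
  obtain ⟨X, Y, rfl⟩ := exists_eq_quatPair A
  rw [hSμ, hPu, hPu, Matrix.conjTranspose_one, Matrix.one_mul, Matrix.mul_one,
    quatStretch_quatPair, one_smul, Matrix.mul_add, Matrix.add_mul, Matrix.mul_smul,
    Matrix.smul_mul]
  simp only [quatMat_mul]

theorem unitaryForm_StretchMaps_of_preservesMulStar {T : Mat2 ℂ →ₗ[ℝ] Mat2 ℂ}
    (hT : Function.Bijective T) (h : PreservesMulStar T) : UnitaryForm StretchMaps T := by
  have h1 : IsNonzeroMultipleOfUnitary (T 1) := by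
    refine isNonzeroMultipleOfUnitary_complex (fun h0 => ?_) fun B => ?_
    · exact one_ne_zero (hT.1 (h0.trans T.map_zero.symm))
    · obtain ⟨B, rfl⟩ := hT.2 B
      exact h 1 B (mulStarRel_one_complex B)
  refine UnitaryForm.of_inv_mul h1 ?_
  have hdet := h1.isUnit_det
  have hb : Function.Bijective (LinearMap.mulLeft ℝ (T 1)⁻¹ ∘ₗ T) :=
    (bijective_inv_mul hdet).comp hT
  exact unitaryForm_StretchMaps_of_map_one hb (Matrix.nonsing_inv_mul _ hdet) (h.inv_mul h1)

theorem exists_linearMap_starConj_complex {T : Mat2 ℂ →ₗ[ℝ] Mat2 ℂ} (hT : Function.Bijective T) :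
    ∃ T' : Mat2 ℂ →ₗ[ℝ] Mat2 ℂ, Function.Bijective T' ∧ ⇑T' = starConj T := by
  let e := Matrix.conjTransposeLinearEquiv (Fin 2) (Fin 2) ℝ ℂ
  exact ⟨e.toLinearMap ∘ₗ T ∘ₗ e.toLinearMap, e.bijective.comp (hT.comp e.bijective), rfl⟩

theorem tfae_complex (T : Mat2 ℂ →ₗ[ℝ] Mat2 ℂ) (hT : Function.Bijective T) :
    List.TFAE [PreservesMulStar T, PreservesStarMul T,
      IsNonzeroMultipleOfUnitary (T 1) ∧ HasComplexForm (fun X => (T 1)⁻¹ * T X)] := by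
  obtain ⟨T', hT', hTT'⟩ := exists_linearMap_starConj_complex hT
  refine tfae_of_unitaryForm (F := StretchMaps) (fun φ => StretchMaps.preservesMulStar)
    (fun φ => StretchMaps.starConj_mem) (unitaryForm_StretchMaps_of_preservesMulStar hT) ?_
    hasComplexForm_iff_unitaryForm
  rw [← hTT']
  exact unitaryForm_StretchMaps_of_preservesMulStar hT'

end Complex

theorem theoremT :
    (∀ T : Mat2 ℝ →ₗ[ℝ] Mat2 ℝ, Function.Bijective T →
      List.TFAE [
        PreservesMulStar T,
        PreservesStarMul T,
        IsNonzeroMultipleOfUnitary (T 1) ∧ HasRealForm (fun X => (T 1)⁻¹ * T X)]) ∧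
    (∀ T : Mat2 ℂ →ₗ[ℝ] Mat2 ℂ, Function.Bijective T →
      List.TFAE [
        PreservesMulStar T,
        PreservesStarMul T,
        IsNonzeroMultipleOfUnitary (T 1) ∧ HasComplexForm (fun X => (T 1)⁻¹ * T X)]) :=
  ⟨tfae_real, tfae_complex⟩
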